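/- **Setting.** Consider $x_{t+1}=Ax_t+Bu_t$, $y_t=Cx_t+Du_t$, $\tilde y_t=y_t+e_t$ for integers $t\ge -n$, with $x_t\in\mathbb R^n$, $u_t\in\mathbb R^m$, $y_t,e_t\in\mathbb R^p$, where $A$ is Schur stable, $(A,B)$ is controllable, $(A,C)$ is observable and the noise $e$ is arbitrary. Put $z_t=(u_t,y_t)\in\mathbb R^{m+p}$; $\|\cdot\|$ is the Euclidean norm and $M^\dagger$ the Moore–Penrose pseudoinverse. A finite sequence $(u_k,y_k)_k$ is a *trajectory* if it is an (exact) input/output sequence of the system for some initial state. Let $\mu\ge\mu^*$, where $\mu^*$ is the least $k$ with $\operatorname{rank}[B\ AB\ \cdots\ A^{k-1}B]=n$. Let $(u^d_k,y^d_k)_{k=0}^{N-1}$ be a trajectory with $u^d$ persistently exciting of order $3n+\mu+1$, i.e. the Hankel matrix satisfies $\operatorname{rank}H_{3n+\mu+1}(u^d)=m(3n+\mu+1)$. Put $U=H_{2n+\mu+1}(u^d)$, $Y=H_{2n+\mu+1}(y^d)$, write $M^{a:b}$ for the block rows $a,\dots,b$ of $M$, and set $$H_\alpha=\begin{bmatrix}U^{1:n}\\U^{n+1:2n+\mu+1}\\Y^{1:n}\end{bmatrix},\quad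 H_\beta=\begin{bmatrix}U^{1:n}\\U^{n+\mu+1:2n+\mu+1}\\Y^{1:n}\\Y^{n+\mu+1:2n+\mu}\end{bmatrix},\quad H=\begin{bmatrix}H_{n+1}(u^d)\\H_{n+1}(y^d)\end{bmatrix},\quad S=(HH^\dagger-I)\begin{bmatrix}1_{n+1}\otimes I_m&0\\0&1_{n+1}\otimes I_p\end{bmatrix}.$$ **Algorithm 1.** Given a step size $\gamma$, a matrix $Q$ with $N-2n-\mu$ columns, and an initialization consisting of $\hat u_{-1}\in\mathbb R^{m(\mu+1)}$, $z^s_{-1}=(u^s_{-1},y^s_{-1})\in\mathbb R^{m+p}$, $u_{[-n:-1]}$, $\tilde y_{[-n:-1]}-\hat e_{[-n:-1]}$, and a function $L_{-1}:\mathbb R^{m+p}\to\mathbb R$. At each time $t\ge0$: (if $t\ge1$) set $\hat e_{t-1}=\tilde y_{t-1}-Y^{n+1}(\alpha_{t-1}+\beta_{t-1})$; choose any $\alpha_t$ with $$H_\alpha\alpha_t=\big(u_{[t-n:t-1]},\ \sigma\hat u_{t-1},\ 1_{n+1}\otimes u^s_{t-1},\ \tilde y_{[t-n:t-1]}-\hat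 e_{[t-n:t-1]}\big),$$ where $\sigma$ drops the first block; put $\hat z^\mu_t=(u^s_{t-1},Y^{n+\mu+1}\alpha_t)$ and $$z^s_t=(u^s_t,y^s_t)=(I-S^\dagger S)\big(\hat z^\mu_t-\gamma\nabla L_{t-1}(\hat z^\mu_t)\big);$$ let $\beta_t=\big(I-(Q(I-H_\beta^\dagger H_\beta))^\dagger Q\big)H_\beta^\dagger g_t$, which is a minimizer of $\|Q\beta\|$ subject to $H_\beta\beta=g_t$, where $$g_t=\big(0,\ 1_{n+1}\otimes u^s_t-U^{n+\mu+1:2n+\mu+1}\alpha_t,\ 0,\ 1_n\otimes y^s_t-Y^{n+\mu+1:2n+\mu}\alpha_t\big);$$ put $\hat u_t=U^{n+1:n+\mu+1}(\alpha_t+\beta_t)$ and apply the input $u_t=U^{n+1}(\alpha_t+\beta_t)$. **Costs.** Let $\alpha_z,l_z,L_z>0$. For every $t\ge0$ the cost $L_t:\mathbb R^{m+p}\to\mathbb R$ is differentiable, $\alpha_z$-strongly convex and $l_z$-smooth on $\mathbb R^{m+p}$, and $L_t$ is Lipschitz continuous with constant $L_z$ on a set $\mathcal Z\subseteq\mathbb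 R^{m+p}$ that contains $z_t$ and $\zeta_t$ for all $t\ge0$. Here $\zeta_t=(\eta_t,\theta_t)$ is the minimizer of $L_t$ over the steady states $\{(u,y):\exists x,\ x=Ax+Bu,\ y=Cx+Du\}$ for $t\ge0$, and $\zeta_{-1}:=z^s_{-1}$. **Theorem.** Let $0<\gamma\le\frac{2}{\alpha_z+l_z}$. There are constants $C_\zeta,C_e<\infty$, depending only on the system, the offline data, $\mu$, $Q$, $\gamma$, $\alpha_z,l_z,L_z$, and for every initialization for which $(u_{[-n:-1]},\tilde y_{[-n:-1]}-\hat e_{[-n:-1]})$ is a trajectory a constant $C_\mu<\infty$, depending only on these quantities and on the initialization, such that for all true initial states, all noise sequences, all costs and all $\mathcal Z$ as above, and every closed loop of the system with Algorithm 1, one has for all $T\ge0$ $$\mathcal R=\sum_{t=0}^T\big(L_t(u_t,y_t)-L_t(\eta_t,\theta_t)\big)\le C_\mu+C_\zeta\sum_{t=0}^T\|\zeta_t-\zeta_{t-1}\|+C_eE_0,\qquad E_0=\|e_{[-n:-1]}-\hat e_{[-n:-1]}\|.$$ In particular the constants are independent of $T$. -/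

import Mathlib

open scoped Matrix

namespace DDOCO

noncomputable section

/-! ### Moore-Penrose pseudoinverse of a real matrix -/

/-- The four Penrose equations. -/
structure IsMoorePenrose {ι κ : Type*} [Fintype ι] [Fintype κ]
    (M : Matrix ι κ ℝ) (X : Matrix κ ι ℝ) : Prop where
  mul_mul : M * X * M = M
  mul_mul' : X * M * X = X
  symm_left : (M * X)ᵀ = M * X
  symm_right : (X * M)ᵀ = X * M

theorem IsMoorePenrose.unique {ι κ : Type*} [Fintype ι] [Fintype κ]
    {M : Matrix ι κ ℝ} {X Y : Matrix κ ι ℝ}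
    (hX : IsMoorePenrose M X) (hY : IsMoorePenrose M Y) : X = Y := by
  have h1 : M * X = M * Y := by
    calc M * X = (M * X)ᵀ := hX.symm_left.symm
      _ = ((M * Y) * (M * X))ᵀ := by
          rw [← Matrix.mul_assoc, hY.mul_mul]
      _ = (M * X) * (M * Y) := by
          rw [Matrix.transpose_mul, hX.symm_left, hY.symm_left]
      _ = M * Y := by rw [← Matrix.mul_assoc, hX.mul_mul]
  have h2 : X * M = Y * M := by
    calc X * M = (X * M)ᵀ := hX.symm_right.symm
      _ = ((X * M) * (Y * M))ᵀ := by
          rw [Matrix.mul_assoc, ← Matrix.mul_assoc M Y M, hY.mul_mul]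
      _ = (Y * M) * (X * M) := by
          rw [Matrix.transpose_mul, hX.symm_right, hY.symm_right]
      _ = Y * M := by rw [Matrix.mul_assoc, ← Matrix.mul_assoc M X M, hX.mul_mul]
  calc X = X * M * X := hX.mul_mul'.symm
    _ = Y * M * X := by rw [h2]
    _ = Y * M * Y := by rw [Matrix.mul_assoc, h1, ← Matrix.mul_assoc]
    _ = Y := hY.mul_mul'

theorem exists_isMoorePenrose {ι κ : Type*} [Fintype ι] [Fintype κ]
    (M : Matrix ι κ ℝ) : ∃ X : Matrix κ ι ℝ, IsMoorePenrose M X := by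
  classical
  have hS : (Mᴴ * M).IsHermitian := Matrix.isHermitian_conjTranspose_mul_self M
  set φ := Unitary.conjStarAlgAut ℝ (Matrix κ κ ℝ) hS.eigenvectorUnitary with hφ
  set D : Matrix κ κ ℝ := Matrix.diagonal hS.eigenvalues with hD
  set D' : Matrix κ κ ℝ := Matrix.diagonal (fun i => (hS.eigenvalues i)⁻¹) with hD'
  have hSD : Mᴴ * M = φ D := by
    have h := hS.spectral_theorem
    have hc : (RCLike.ofReal ∘ hS.eigenvalues : κ → ℝ) = hS.eigenvalues := by
      ext i; simp
    rw [hc] at h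
    exact h
  set G := φ D' with hG
  have e1 : D * D' * D = D := by
    simp only [hD, hD', Matrix.diagonal_mul_diagonal]
    congr 1; ext i
    exact mul_inv_mul_cancel _
  have e2 : D' * D * D' = D' := by
    simp only [hD, hD', Matrix.diagonal_mul_diagonal]
    congr 1; ext i
    simpa only [inv_inv] using mul_inv_mul_cancel (hS.eigenvalues i)⁻¹
  have f1 : (Mᴴ * M) * G * (Mᴴ * M) = Mᴴ * M := by
    rw [hSD, hG, ← map_mul, ← map_mul, e1]
  have f2 : G * (Mᴴ * M) * G = G := by
    rw [hSD, hG, ← map_mul, ← map_mul, e2]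
  have f3 : Gᴴ = G := by
    rw [hG, ← Matrix.star_eq_conjTranspose, ← map_star]
    congr 1
    simp [hD', Matrix.star_eq_conjTranspose]
  have f4 : (G * (Mᴴ * M))ᴴ = G * (Mᴴ * M) := by
    have hc : D' * D = D * D' := by
      simp only [hD, hD', Matrix.diagonal_mul_diagonal, mul_comm]
    rw [Matrix.conjTranspose_mul, f3, hS.eq, hSD, hG, ← map_mul, ← map_mul, hc]
  refine ⟨G * Mᴴ, ?_, ?_, ?_, ?_⟩
  · have h0 : (Mᴴ * M) * (G * (Mᴴ * M) - 1) = 0 := by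
      rw [Matrix.mul_sub, ← Matrix.mul_assoc, f1, Matrix.mul_one, sub_self]
    have h1 := (Matrix.conjTranspose_mul_self_mul_eq_zero M _).1 h0
    rw [Matrix.mul_sub, Matrix.mul_one, sub_eq_zero] at h1
    simpa only [Matrix.mul_assoc] using h1
  · calc G * Mᴴ * M * (G * Mᴴ) = (G * (Mᴴ * M) * G) * Mᴴ := by
          simp only [Matrix.mul_assoc]
      _ = G * Mᴴ := by rw [f2]
  · rw [← Matrix.conjTranspose_eq_transpose_of_trivial, Matrix.conjTranspose_mul,
      Matrix.conjTranspose_mul, Matrix.conjTranspose_conjTranspose, f3, Matrix.mul_assoc]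
  · rw [← Matrix.conjTranspose_eq_transpose_of_trivial, Matrix.mul_assoc, f4]

/-- The Moore-Penrose pseudoinverse `M†`. -/
def pinv {ι κ : Type*} [Fintype ι] [Fintype κ] (M : Matrix ι κ ℝ) : Matrix κ ι ℝ :=
  (exists_isMoorePenrose M).choose

theorem pinv_spec {ι κ : Type*} [Fintype ι] [Fintype κ] (M : Matrix ι κ ℝ) :
    IsMoorePenrose M (pinv M) :=
  (exists_isMoorePenrose M).choose_spec

/-! ### Linear time-invariant systems -/

/-- The system `x⁺ = A x + B u`, `y = C x + D u` with `n` states, `m` inputs, `p` outputs. -/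
structure LTI (n m p : ℕ) where
  A : Matrix (Fin n) (Fin n) ℝ
  B : Matrix (Fin n) (Fin m) ℝ
  C : Matrix (Fin p) (Fin n) ℝ
  D : Matrix (Fin p) (Fin m) ℝ

/-- All complex eigenvalues of `A` lie in the open unit disc. -/
def LTI.SchurStable {n m p : ℕ} (sys : LTI n m p) : Prop :=
  ∀ z ∈ spectrum ℂ (sys.A.map (algebraMap ℝ ℂ)), ‖z‖ < 1

/-- The matrix `[B  A B  …  A ^ (k - 1) B]`. -/
def LTI.ctrbMatrix {n m p : ℕ} (sys : LTI n m p) (k : ℕ) :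
    Matrix (Fin n) (Fin k × Fin m) ℝ :=
  Matrix.of fun i q => (sys.A ^ (q.1 : ℕ) * sys.B) i q.2

/-- The matrix with block rows `C, C A, …, C A ^ (n - 1)`. -/
def LTI.obsvMatrix {n m p : ℕ} (sys : LTI n m p) : Matrix (Fin n × Fin p) (Fin n) ℝ :=
  Matrix.of fun q j => (sys.C * sys.A ^ (q.1 : ℕ)) q.2 j

def LTI.Controllable {n m p : ℕ} (sys : LTI n m p) : Prop :=
  (sys.ctrbMatrix n).rank = n

def LTI.Observable {n m p : ℕ} (sys : LTI n m p) : Prop :=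
  sys.obsvMatrix.rank = n

/-- The controllability index: the least `k` with `rank [B  A B  …  A ^ (k - 1) B] = n`. -/
def LTI.ctrbIndex {n m p : ℕ} (sys : LTI n m p) : ℕ :=
  sInf {k : ℕ | (sys.ctrbMatrix k).rank = n}

/-- `(u, y)` is an input/output sequence (trajectory) of length `ℓ` of the system. -/
def LTI.IsTrajectory {n m p : ℕ} (sys : LTI n m p) {ℓ : ℕ}
    (u : Fin ℓ → Fin m → ℝ) (y : Fin ℓ → Fin p → ℝ) : Prop :=
  ∃ x : ℕ → Fin n → ℝ, ∀ k : Fin ℓ,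
    x (k + 1) = sys.A *ᵥ x k + sys.B *ᵥ u k ∧ y k = sys.C *ᵥ x k + sys.D *ᵥ u k

/-- Stacked input-output pairs `z = (u, y) ∈ ℝ^(m+p)`, with the Euclidean norm. -/
abbrev IOSpace (m p : ℕ) : Type := EuclideanSpace ℝ (Fin m ⊕ Fin p)

def ioPair {m p : ℕ} (u : Fin m → ℝ) (y : Fin p → ℝ) : IOSpace m p :=
  WithLp.toLp 2 (Sum.elim u y)

def inPart {m p : ℕ} (z : IOSpace m p) : Fin m → ℝ := fun i => z (Sum.inl i)

def outPart {m p : ℕ} (z : IOSpace m p) : Fin p → ℝ := fun i => z (Sum.inr i)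

/-- The steady states of the system, as input-output pairs. -/
def LTI.steadyStates {n m p : ℕ} (sys : LTI n m p) : Set (IOSpace m p) :=
  {z | ∃ x : Fin n → ℝ, x = sys.A *ᵥ x + sys.B *ᵥ inPart z ∧
    outPart z = sys.C *ᵥ x + sys.D *ᵥ inPart z}

/-- `ζ` minimizes the cost `f` over the steady states of the system. -/
def LTI.IsOptimalSteadyState {n m p : ℕ} (sys : LTI n m p) (f : IOSpace m p → ℝ)
    (ζ : IOSpace m p) : Prop :=
  ζ ∈ sys.steadyStates ∧ ∀ z ∈ sys.steadyStates, f ζ ≤ f z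

/-! ### Cost functions -/

/-- `f` is (globally) `a`-strongly convex and `l`-smooth. -/
structure StronglyConvexSmooth {m p : ℕ} (a l : ℝ) (f : IOSpace m p → ℝ) : Prop where
  differentiable : Differentiable ℝ f
  strongly_convex : ∀ z₁ z₂ : IOSpace m p,
    f z₂ + inner ℝ (gradient f z₂) (z₁ - z₂) + a / 2 * ‖z₁ - z₂‖ ^ 2 ≤ f z₁
  smooth : ∀ z₁ z₂ : IOSpace m p,
    f z₁ ≤ f z₂ + inner ℝ (gradient f z₂) (z₁ - z₂) + l / 2 * ‖z₁ - z₂‖ ^ 2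

/-! ### Hankel matrices -/

/-- The Hankel matrix `H_L(w)` of depth `L` of a sequence `w_0, …, w_{N-1}` in `ℝ^q`; it has
`N - L + 1` columns (none if `N < L`). -/
def hankel {N q : ℕ} (w : Fin N → Fin q → ℝ) (L : ℕ) :
    Matrix (Fin L × Fin q) (Fin (N + 1 - L)) ℝ :=
  Matrix.of fun r j => w ⟨(r.1 : ℕ) + (j : ℕ), by have := r.1.2; have := j.2; omega⟩ r.2

/-- The `k` consecutive block rows of a block matrix that follow its first `a` block rows; in
one-based notation these are the block rows `a + 1 : a + k`. -/
def blockRows {L q K : ℕ} (M : Matrix (Fin L × Fin q) (Fin K) ℝ) (a k : ℕ) (h : a + k ≤ L) :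
    Matrix (Fin k × Fin q) (Fin K) ℝ :=
  Matrix.of fun r j => M (⟨a + (r.1 : ℕ), by have := r.1.2; omega⟩, r.2) j

/-- The single block row that follows the first `a` block rows (number `a + 1`, one-based). -/
def blockRow {L q K : ℕ} (M : Matrix (Fin L × Fin q) (Fin K) ℝ) (a : ℕ) (h : a < L) :
    Matrix (Fin q) (Fin K) ℝ :=
  Matrix.of fun c j => M (⟨a, h⟩, c) j

/-- Persistency of excitation of order `L`. -/
def PersistentlyExciting {N q : ℕ} (w : Fin N → Fin q → ℝ) (L : ℕ) : Prop :=
  (hankel w L).rank = q * L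

/-- A finite sequence of vectors as one stacked vector. -/
def stack {k q : ℕ} (w : Fin k → Fin q → ℝ) : Fin k × Fin q → ℝ := fun r => w r.1 r.2

/-- `1_k ⊗ v`. -/
def repeated (k : ℕ) {q : ℕ} (v : Fin q → ℝ) : Fin k × Fin q → ℝ := fun r => v r.2

/-- `1_k ⊗ I_q`. -/
def repeatedId (k q : ℕ) : Matrix (Fin k × Fin q) (Fin q) ℝ :=
  Matrix.of fun r c => if r.2 = c then 1 else 0

/-! ### The data-driven algorithm -/

/-- Offline data `(u^d, y^d)` of length `N`, weight `Q` and step size `γ`, for state dimension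
`n` and prediction horizon `μ`. -/
structure AlgParams (n m p μ N r : ℕ) where
  ud : Fin N → Fin m → ℝ
  yd : Fin N → Fin p → ℝ
  Q : Matrix (Fin r) (Fin (N + 1 - (2 * n + μ + 1))) ℝ
  γ : ℝ

namespace AlgParams

variable {n m p μ N r : ℕ} (P : AlgParams n m p μ N r)

/-- `U = H_{2n+μ+1}(u^d)`. -/
def U : Matrix (Fin (2 * n + μ + 1) × Fin m) (Fin (N + 1 - (2 * n + μ + 1))) ℝ :=
  hankel P.ud (2 * n + μ + 1)

/-- `Y = H_{2n+μ+1}(y^d)`. -/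
def Y : Matrix (Fin (2 * n + μ + 1) × Fin p) (Fin (N + 1 - (2 * n + μ + 1))) ℝ :=
  hankel P.yd (2 * n + μ + 1)

/-- Block rows `U^{1:n}`, `U^{n+1:2n+μ+1}` (split as `μ` and `n+1` block rows), `Y^{1:n}`. -/
def Hα : Matrix ((Fin n × Fin m) ⊕ ((Fin μ × Fin m) ⊕ (Fin (n + 1) × Fin m)) ⊕ (Fin n × Fin p))
    (Fin (N + 1 - (2 * n + μ + 1))) ℝ :=
  Matrix.fromRows (blockRows P.U 0 n (by omega))
    (Matrix.fromRows
      (Matrix.fromRows (blockRows P.U n μ (by omega)) (blockRows P.U (n + μ) (n + 1) (by omega)))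
      (blockRows P.Y 0 n (by omega)))

/-- Block rows `U^{1:n}`, `U^{n+μ+1:2n+μ+1}`, `Y^{1:n}`, `Y^{n+μ+1:2n+μ}`. -/
def Hβ : Matrix ((Fin n × Fin m) ⊕ (Fin (n + 1) × Fin m) ⊕ (Fin n × Fin p) ⊕ (Fin n × Fin p))
    (Fin (N + 1 - (2 * n + μ + 1))) ℝ :=
  Matrix.fromRows (blockRows P.U 0 n (by omega))
    (Matrix.fromRows (blockRows P.U (n + μ) (n + 1) (by omega))
      (Matrix.fromRows (blockRows P.Y 0 n (by omega)) (blockRows P.Y (n + μ) n (by omega))))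

/-- The stacked Hankel matrix of depth `n + 1` of inputs and outputs. -/
def Hss : Matrix ((Fin (n + 1) × Fin m) ⊕ (Fin (n + 1) × Fin p)) (Fin (N + 1 - (n + 1))) ℝ :=
  Matrix.fromRows (hankel P.ud (n + 1)) (hankel P.yd (n + 1))

/-- The matrix `S = (H H† - I) diag(1_{n+1} ⊗ I_m, 1_{n+1} ⊗ I_p)`. -/
def S : Matrix ((Fin (n + 1) × Fin m) ⊕ (Fin (n + 1) × Fin p)) (Fin m ⊕ Fin p) ℝ :=
  (P.Hss * pinv P.Hss - 1) *
    Matrix.fromBlocks (repeatedId (n + 1) m) 0 0 (repeatedId (n + 1) p)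

/-- The vector `g_t`, the right-hand side of the linear constraint `H_β β = g_t`. -/
def gVec (zs : IOSpace m p) (α : Fin (N + 1 - (2 * n + μ + 1)) → ℝ) :
    (Fin n × Fin m) ⊕ (Fin (n + 1) × Fin m) ⊕ (Fin n × Fin p) ⊕ (Fin n × Fin p) → ℝ :=
  Sum.elim 0 (Sum.elim
    (repeated (n + 1) (inPart zs) - blockRows P.U (n + μ) (n + 1) (by omega) *ᵥ α)
    (Sum.elim 0 (repeated n (outPart zs) - blockRows P.Y (n + μ) n (by omega) *ᵥ α)))

/-- The matrix `(I - (Q (I - H_β† H_β))† Q) H_β†`, which maps `g` to a minimizer of `‖Q β‖`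
subject to `H_β β = g` (the only one if `Qᵀ Q` is positive definite). -/
def solveβ : Matrix (Fin (N + 1 - (2 * n + μ + 1)))
    ((Fin n × Fin m) ⊕ (Fin (n + 1) × Fin m) ⊕ (Fin n × Fin p) ⊕ (Fin n × Fin p)) ℝ :=
  (1 - pinv (P.Q * (1 - pinv P.Hβ * P.Hβ)) * P.Q) * pinv P.Hβ

end AlgParams

/-- What the algorithm is initialized with: `û_{-1}`, `z^s_{-1}`, `u_{[-n:-1]}`,
`ỹ_{[-n:-1]} - ê_{[-n:-1]}`, and the function `L_{-1}` that is used in its first gradient step. -/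
structure AlgInit (n m p μ : ℕ) where
  uhat : Fin (μ + 1) → Fin m → ℝ
  zs : IOSpace m p
  u : Fin n → Fin m → ℝ
  yc : Fin n → Fin p → ℝ
  cost : IOSpace m p → ℝ

/-- The signals of the closed loop, with integer time; `K` is the number of columns of the
Hankel matrices. Only the values at the times that occur in `IsClosedLoop` matter. -/
structure Signals (n m p μ K : ℕ) where
  /-- state -/
  x : ℤ → Fin n → ℝ
  /-- input -/
  u : ℤ → Fin m → ℝ
  /-- true output -/
  y : ℤ → Fin p → ℝ
  /-- measurement noise -/
  e : ℤ → Fin p → ℝ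
  /-- measured output -/
  ym : ℤ → Fin p → ℝ
  /-- estimate of the noise -/
  ehat : ℤ → Fin p → ℝ
  /-- predicted inputs -/
  uhat : ℤ → Fin (μ + 1) → Fin m → ℝ
  α : ℤ → Fin K → ℝ
  β : ℤ → Fin K → ℝ
  /-- prediction `μ` steps ahead -/
  zμ : ℤ → IOSpace m p
  /-- estimate of the optimal steady state -/
  zs : ℤ → IOSpace m p

/-- The input-output pair `z_t = (u_t, y_t)`. -/
def Signals.z {n m p μ K : ℕ} (σ : Signals n m p μ K) (t : ℤ) : IOSpace m p :=
  ioPair (σ.u t) (σ.y t)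

/-- The window `w_{[t-n:t-1]}` of a signal. -/
def window {q : ℕ} (n : ℕ) (w : ℤ → Fin q → ℝ) (t : ℤ) : Fin n → Fin q → ℝ :=
  fun i => w (t - n + (i : ℕ))

/-- `E_0`, the Euclidean norm of `e_{[-n:-1]} - ê_{[-n:-1]}`. -/
def Signals.E₀ {n m p μ K : ℕ} (σ : Signals n m p μ K) : ℝ :=
  ‖(WithLp.toLp 2 (stack (window n σ.e 0) - stack (window n σ.ehat 0)) :
    EuclideanSpace ℝ (Fin n × Fin p))‖

/-- `σ` is a closed loop of the system and the algorithm: the system runs from time `-n`, the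
algorithm from time `0`. The coefficient `α_t` may be any solution of its linear equation. -/
structure IsClosedLoop {n m p μ N r : ℕ} (sys : LTI n m p) (P : AlgParams n m p μ N r)
    (init : AlgInit n m p μ) (cost : ℤ → IOSpace m p → ℝ)
    (σ : Signals n m p μ (N + 1 - (2 * n + μ + 1))) : Prop where
  state_eq : ∀ t : ℤ, -(n : ℤ) ≤ t → σ.x (t + 1) = sys.A *ᵥ σ.x t + sys.B *ᵥ σ.u t
  output_eq : ∀ t : ℤ, -(n : ℤ) ≤ t → σ.y t = sys.C *ᵥ σ.x t + sys.D *ᵥ σ.u t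
  measured_eq : ∀ t : ℤ, -(n : ℤ) ≤ t → σ.ym t = σ.y t + σ.e t
  init_u : window n σ.u 0 = init.u
  init_y : window n σ.ym 0 - window n σ.ehat 0 = init.yc
  init_uhat : σ.uhat (-1) = init.uhat
  init_zs : σ.zs (-1) = init.zs
  init_cost : cost (-1) = init.cost
  ehat_eq : ∀ t : ℤ, 0 ≤ t →
    σ.ehat t = σ.ym t - blockRow P.Y n (by omega) *ᵥ (σ.α t + σ.β t)
  α_eq : ∀ t : ℤ, 0 ≤ t → P.Hα *ᵥ σ.α t =
    Sum.elim (stack (window n σ.u t))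
      (Sum.elim
        (Sum.elim (stack fun i : Fin μ => σ.uhat (t - 1) i.succ)
          (repeated (n + 1) (inPart (σ.zs (t - 1)))))
        (stack (window n σ.ym t - window n σ.ehat t)))
  zμ_eq : ∀ t : ℤ, 0 ≤ t → σ.zμ t =
    ioPair (inPart (σ.zs (t - 1))) (blockRow P.Y (n + μ) (by omega) *ᵥ σ.α t)
  zs_eq : ∀ t : ℤ, 0 ≤ t → σ.zs t = WithLp.toLp 2 ((1 - pinv P.S * P.S) *ᵥ
    WithLp.ofLp (σ.zμ t - P.γ • gradient (cost (t - 1)) (σ.zμ t)))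
  β_eq : ∀ t : ℤ, 0 ≤ t → σ.β t = P.solveβ *ᵥ P.gVec (σ.zs t) (σ.α t)
  uhat_eq : ∀ t : ℤ, 0 ≤ t →
    stack (σ.uhat t) = blockRows P.U n (μ + 1) (by omega) *ᵥ (σ.α t + σ.β t)
  u_eq : ∀ t : ℤ, 0 ≤ t → σ.u t = blockRow P.U n (by omega) *ᵥ (σ.α t + σ.β t)

end

end DDOCO

namespace DDOCO

/-! ### Linear algebra -/

/-! A coefficient vector `g` is identified with the trajectory `comb g` that it generates from the
data. By observability, `n` input-output samples fix the state of such a trajectory; by persistency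
of excitation (`LTI.exists_comb_eq`), every initial state and input sequence is generated. All
equations of the algorithm thus become statements about trajectories.

Noise: `ê` is defined so that the corrected output `ỹ - ê` is the value predicted by `α + β`. Hence
inputs and corrected outputs form an exact trajectory (`IsClosedLoop.estimate`), a noise-free
simulation run beside the plant. The plant differs from it by a free response of `A`, which is
summable and starts at size `O(E₀)`. Later noise never enters.

Steady states: the kernel of `S` is the set of steady states, so `zs` is an orthogonal projection
onto it. From time 1 on, `α` predicts arrival at the previous `zs`, whence `zμ (t + 1) = zs t`
(`IsClosedLoop.zμ_succ`). So `zs` is plain projected gradient descent, which contracts towards the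
current minimizer `ζ`; summing the contraction bounds `∑ ‖zs - ζ‖`, and with it the total variation
of `zs`, by a constant plus a multiple of the path length of `ζ`.

Tracking: the vector `g` consists of zeros and differences of consecutive `zs`, so `β` has the size
of that change. A planned input is shifted forward at most `μ` times before it is applied, and each
shift adds one such error (`sum_le_of_cascade`). With the summable gain of a Schur stable system
this gives `∑ ‖z - zs‖ ≤ A + c ∑ ‖zs (t + 1) - zs t‖ + ce * E₀` (`exists_tracking_bound`). Lipschitz
continuity of the costs turns the distances into regret. -/

theorem exists_norm_mulVec_le {ι κ : Type*} [Fintype ι] [Fintype κ] (M : Matrix ι κ ℝ) :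
    ∃ c, 0 ≤ c ∧ ∀ v, ‖M *ᵥ v‖ ≤ c * ‖v‖ :=
  ⟨‖M.mulVecLin.toContinuousLinearMap‖, norm_nonneg _,
    fun v => M.mulVecLin.toContinuousLinearMap.le_opNorm v⟩

theorem mulVec_surjective_of_rank {ι κ : Type*} [Fintype ι] [Fintype κ] {M : Matrix ι κ ℝ}
    (h : M.rank = Fintype.card ι) (w : ι → ℝ) : ∃ v, M *ᵥ v = w := by
  have h1 : LinearMap.range M.mulVecLin = ⊤ := by
    apply Submodule.eq_top_of_finrank_eq
    rw [Module.finrank_fintype_fun_eq_card, ← h]; rfl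
  have h2 : w ∈ LinearMap.range M.mulVecLin := h1 ▸ Submodule.mem_top
  exact h2

theorem exists_mul_eq_one_of_rank {ι κ : Type*} [Fintype ι] [Fintype κ] [DecidableEq κ]
    {M : Matrix ι κ ℝ} (h : M.rank = Fintype.card κ) : ∃ G : Matrix κ ι ℝ, G * M = 1 := by
  have h1 : ∀ w : κ → ℝ, ∃ v, Mᵀ *ᵥ v = w :=
    mulVec_surjective_of_rank (by rw [Matrix.rank_transpose, h])
  choose g hg using fun i => h1 (Pi.single i 1)
  refine ⟨Matrix.of g, ?_⟩
  ext i j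
  have := congrFun (hg i) j
  rw [Matrix.mulVec_transpose] at this
  rw [Matrix.one_apply, Matrix.mul_apply]
  simp only [Matrix.vecMul, dotProduct] at this
  simp only [Matrix.of_apply, this, Pi.single_apply, eq_comm]

theorem mulVec_pinv_mulVec {ι κ : Type*} [Fintype ι] [Fintype κ] (M : Matrix ι κ ℝ)
    {w : ι → ℝ} (h : ∃ v, M *ᵥ v = w) : M *ᵥ (pinv M *ᵥ w) = w := by
  obtain ⟨v, rfl⟩ := h
  rw [Matrix.mulVec_mulVec, Matrix.mulVec_mulVec, (pinv_spec M).mul_mul]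

/-- The range of `(Q E)†` lies in the range of `(Q E)ᵀ = E Qᵀ`, and `H E = 0`; the weighting
therefore moves the solution only inside the kernel of `H`. Only feasibility of `β` matters below,
not minimality. -/
theorem mul_weighted_pinv {ι κ ρ : Type*} [Fintype ι] [Fintype κ] [Fintype ρ] [DecidableEq κ]
    (H : Matrix ι κ ℝ) (Q : Matrix ρ κ ℝ) :
    H * ((1 - pinv (Q * (1 - pinv H * H)) * Q) * pinv H) = H * pinv H := by
  set E := 1 - pinv H * H with hE
  set X := pinv (Q * E) with hX
  have hX' := pinv_spec (Q * E)
  rw [← hX] at hX'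
  have hEs : Eᵀ = E := by
    rw [hE, Matrix.transpose_sub, (pinv_spec H).symm_right, Matrix.transpose_one]
  have hHE : H * E = 0 := by
    rw [hE, Matrix.mul_sub, Matrix.mul_one, ← Matrix.mul_assoc, (pinv_spec H).mul_mul, sub_self]
  have hHX : H * X = 0 := by
    rw [← hX'.mul_mul', ← hX'.symm_right, Matrix.transpose_mul, Matrix.transpose_mul, hEs]
    simp only [← Matrix.mul_assoc, hHE, Matrix.zero_mul]
  rw [Matrix.sub_mul, Matrix.mul_sub, Matrix.one_mul]
  simp only [← Matrix.mul_assoc, hHX, Matrix.zero_mul, sub_zero]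

/-- The orthogonal projection onto the kernel of `M`. -/
noncomputable def kerProj {ι κ : Type*} [Fintype ι] [Fintype κ] [DecidableEq κ]
    (M : Matrix ι κ ℝ) : EuclideanSpace ℝ κ →ₗ[ℝ] EuclideanSpace ℝ κ :=
  Matrix.toLpLin 2 2 (1 - pinv M * M)

section kerProj

variable {ι κ : Type*} [Fintype ι] [Fintype κ] [DecidableEq κ] (M : Matrix ι κ ℝ)

theorem kerProj_apply (z : EuclideanSpace ℝ κ) :
    kerProj M z = WithLp.toLp 2 ((1 - pinv M * M) *ᵥ WithLp.ofLp z) := rfl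

theorem mulVec_kerProj (z : EuclideanSpace ℝ κ) : M *ᵥ WithLp.ofLp (kerProj M z) = 0 := by
  rw [kerProj_apply]
  simp only [Matrix.mulVec_mulVec, Matrix.mul_sub, Matrix.mul_one, ← Matrix.mul_assoc,
    (pinv_spec M).mul_mul, sub_self, Matrix.zero_mulVec]

theorem kerProj_of_mulVec_eq_zero {z : EuclideanSpace ℝ κ} (h : M *ᵥ WithLp.ofLp z = 0) :
    kerProj M z = z := by
  rw [kerProj_apply, Matrix.sub_mulVec, Matrix.one_mulVec, ← Matrix.mulVec_mulVec, h,
    Matrix.mulVec_zero, sub_zero]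

/-- The matrix `1 - M† M` is symmetric by the Penrose equations and fixes its own range, so it is an
orthogonal projection. -/
theorem inner_kerProj_self (z : EuclideanSpace ℝ κ) :
    inner ℝ z (kerProj M z) = ‖kerProj M z‖ ^ 2 := by
  have hs : (1 - pinv M * M)ᵀ = 1 - pinv M * M := by
    rw [Matrix.transpose_sub, (pinv_spec M).symm_right, Matrix.transpose_one]
  have hi : (1 - pinv M * M) *ᵥ WithLp.ofLp (kerProj M z) = WithLp.ofLp (kerProj M z) :=
    congrArg WithLp.ofLp (kerProj_of_mulVec_eq_zero M (mulVec_kerProj M z))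
  rw [← real_inner_self_eq_norm_sq]
  simp only [EuclideanSpace.inner_eq_star_dotProduct, star_trivial]
  change _ = WithLp.ofLp (kerProj M z) ⬝ᵥ ((1 - pinv M * M) *ᵥ WithLp.ofLp z)
  rw [Matrix.dotProduct_mulVec, ← Matrix.mulVec_transpose, hs, hi]

theorem norm_kerProj_le (z : EuclideanSpace ℝ κ) : ‖kerProj M z‖ ≤ ‖z‖ := by
  have h := inner_kerProj_self M z
  have h2 := real_inner_le_norm z (kerProj M z)
  by_contra! hlt
  nlinarith [norm_nonneg z]

end kerProj

/-! ### Projected gradient steps -/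

theorem StronglyConvexSmooth.mono {m p : ℕ} {a a' l : ℝ} {f : IOSpace m p → ℝ}
    (hf : StronglyConvexSmooth a l f) (h : a' ≤ a) : StronglyConvexSmooth a' l f where
  differentiable := hf.differentiable
  smooth := hf.smooth
  strongly_convex z₁ z₂ := by
    have := hf.strongly_convex z₁ z₂
    nlinarith [sq_nonneg ‖z₁ - z₂‖]

/-- With `d` the gradient increment of `f - a/2 ‖·‖²`, the value of `f` at `y - d/(l - a)` is
bounded below by strong convexity at `x` and above by smoothness at `y`. This step length is the
best one for `(l - a)`-smoothness. -/
theorem StronglyConvexSmooth.gradient_gap {m p : ℕ} {a l : ℝ} {f : IOSpace m p → ℝ}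
    (hf : StronglyConvexSmooth a l f) (hal : a < l) (x y : IOSpace m p) :
    ‖gradient f y - gradient f x - a • (y - x)‖ ^ 2 / (2 * (l - a)) ≤
      f y - f x - inner ℝ (gradient f x) (y - x) - a / 2 * ‖y - x‖ ^ 2 := by
  set gx := gradient f x
  set gy := gradient f y
  set w := y - x with hw
  set d := gy - gx - a • w with hd
  set s := 1 / (l - a) with hs
  have h1 := hf.strongly_convex (y - s • d) x
  have h2 := hf.smooth (y - s • d) y
  have e1 : y - s • d - x = w - s • d := by rw [hw]; abel
  have e2 : y - s • d - y = -(s • d) := by abel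
  rw [e1] at h1
  rw [e2, norm_neg, norm_smul, mul_pow, inner_neg_right, inner_smul_right] at h2
  rw [norm_sub_sq_real, inner_sub_right, inner_smul_right, inner_smul_right, norm_smul,
    mul_pow] at h1
  have h3 : inner ℝ gy d - inner ℝ gx d - a * inner ℝ w d = ‖d‖ ^ 2 := by
    rw [← real_inner_self_eq_norm_sq]
    calc _ = inner ℝ (gy - gx - a • w) d := by
          rw [inner_sub_left (gy - gx), inner_sub_left gy, inner_smul_left]; rfl
      _ = inner ℝ d d := rfl
  have hs2 : ‖s‖ ^ 2 = s ^ 2 := by rw [Real.norm_eq_abs, sq_abs]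
  rw [hs2] at h1 h2
  have hpos : 0 < l - a := sub_pos.2 hal
  have hls : (l - a) * s = 1 := by rw [hs]; field_simp
  have e3 : ‖d‖ ^ 2 / (2 * (l - a)) = s / 2 * ‖d‖ ^ 2 := by rw [hs]; field_simp
  rw [e3]
  have h4 : s * (inner ℝ gy d - inner ℝ gx d - a * inner ℝ w d) = s * ‖d‖ ^ 2 := by rw [h3]
  have h5 : (l - a) * s * s * ‖d‖ ^ 2 = s * ‖d‖ ^ 2 := by rw [hls, one_mul]
  change f x + (inner ℝ gx w - s * inner ℝ gx d) +
    a / 2 * (‖w‖ ^ 2 - 2 * (s * inner ℝ w d) + s ^ 2 * ‖d‖ ^ 2) ≤ _ at h1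
  nlinarith

/-- Sum of `gradient_gap` for `(x, y)` and for `(y, x)`; the function values cancel. -/
theorem StronglyConvexSmooth.coercive {m p : ℕ} {a l : ℝ} {f : IOSpace m p → ℝ}
    (hf : StronglyConvexSmooth a l f) (hal : a < l) (x y : IOSpace m p) :
    ‖gradient f y - gradient f x‖ ^ 2 + a * l * ‖y - x‖ ^ 2 ≤
      (a + l) * inner ℝ (y - x) (gradient f y - gradient f x) := by
  have h1 := hf.gradient_gap hal x y
  have h2 := hf.gradient_gap hal y x
  have e1 : gradient f x - gradient f y - a • (x - y) =
      -(gradient f y - gradient f x - a • (y - x)) := by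
    rw [← neg_sub y x, smul_neg]; abel
  rw [e1, norm_neg, ← neg_sub y x, norm_neg, inner_neg_right] at h2
  set g := gradient f y - gradient f x with hg
  have e2 : inner ℝ (y - x) g =
      inner ℝ (gradient f y) (y - x) - inner ℝ (gradient f x) (y - x) := by
    rw [real_inner_comm, hg, inner_sub_left]
  have hpos : 0 < l - a := sub_pos.2 hal
  have h3 : ‖g - a • (y - x)‖ ^ 2 / (l - a) ≤ inner ℝ (y - x) g - a * ‖y - x‖ ^ 2 := by
    have : ‖g - a • (y - x)‖ ^ 2 / (l - a) = 2 * (‖g - a • (y - x)‖ ^ 2 / (2 * (l - a))) := by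
      field_simp
    rw [this, e2]; linarith
  rw [div_le_iff₀ hpos, norm_sub_sq_real, inner_smul_right, norm_smul, mul_pow, Real.norm_eq_abs,
    sq_abs, real_inner_comm] at h3
  nlinarith

/-- The rate of contraction of projected gradient steps. -/
noncomputable def gradientRate (a l γ : ℝ) : ℝ :=
  √(1 - 2 * γ * (min a (l / 2) * l) / (min a (l / 2) + l))

theorem gradientRate_lt_one {a l γ : ℝ} (ha : 0 < a) (hl : 0 < l) (hγ : 0 < γ) :
    gradientRate a l γ < 1 := by
  have h : 0 < min a (l / 2) := lt_min ha (by linarith)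
  rw [gradientRate, Real.sqrt_lt' one_pos]
  have : 0 < 2 * γ * (min a (l / 2) * l) / (min a (l / 2) + l) := by positivity
  linarith

theorem StronglyConvexSmooth.norm_gradient_step_le {m p : ℕ} {a l γ : ℝ} {f : IOSpace m p → ℝ}
    (hf : StronglyConvexSmooth a l f) (ha : 0 < a) (hl : 0 < l) (hγ : 0 < γ)
    (hγ' : γ ≤ 2 / (a + l)) (x y : IOSpace m p) :
    ‖(y - x) - γ • (gradient f y - gradient f x)‖ ≤ gradientRate a l γ * ‖y - x‖ := by
  -- `coercive` needs the convexity constant strictly below `l`, which fails for `a = l`. Lowering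
  -- it to `b` costs only the rate, and `γ ≤ 2 / (a + l)` still implies `γ ≤ 2 / (b + l)`.
  set b := min a (l / 2) with hb
  have hb0 : 0 < b := lt_min ha (by linarith)
  have hbl : b < l := (min_le_right _ _).trans_lt (by linarith)
  have h := (hf.mono (min_le_left a (l / 2))).coercive hbl x y
  rw [← hb] at h
  have hγb : γ * (b + l) ≤ 2 := by
    rw [le_div_iff₀ (by linarith)] at hγ'
    have : b ≤ a := min_le_left _ _
    nlinarith
  set g := gradient f y - gradient f x
  have h1 : ‖(y - x) - γ • g‖ ^ 2 ≤ (1 - 2 * γ * (b * l) / (b + l)) * ‖y - x‖ ^ 2 := by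
    rw [norm_sub_sq_real, inner_smul_right, norm_smul, mul_pow, Real.norm_eq_abs, sq_abs]
    have hbl0 : 0 < b + l := by linarith
    have e : (1 - 2 * γ * (b * l) / (b + l)) * ‖y - x‖ ^ 2 =
        ((b + l) * ‖y - x‖ ^ 2 - 2 * γ * (b * l) * ‖y - x‖ ^ 2) / (b + l) := by field_simp
    rw [e, le_div_iff₀ hbl0]
    nlinarith [mul_le_mul_of_nonneg_left h (mul_nonneg zero_le_two hγ.le),
      mul_nonneg (mul_nonneg hγ.le (sub_nonneg.2 hγb)) (sq_nonneg ‖g‖)]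
  rw [gradientRate, ← hb]
  -- The square root is zero on negative numbers; instead of checking the sign, a nonpositive
  -- radicand is seen to force the left-hand side to vanish.
  rcases le_total 0 (1 - 2 * γ * (b * l) / (b + l)) with h0 | h0
  · apply le_of_sq_le_sq _ (by positivity)
    rw [mul_pow, Real.sq_sqrt h0]
    exact h1
  · have h2 : ‖(y - x) - γ • g‖ ^ 2 ≤ 0 :=
      h1.trans (mul_nonpos_of_nonpos_of_nonneg h0 (sq_nonneg _))
    have h3 : ‖(y - x) - γ • g‖ = 0 := by
      have := le_antisymm h2 (sq_nonneg _)
      exact pow_eq_zero_iff two_ne_zero |>.1 this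
    rw [h3]; positivity

/-- Otherwise the step `-(1/l) v` along the projected gradient `v` stays in the kernel and lowers
`f` by at least `‖v‖² / (2l)`. -/
theorem StronglyConvexSmooth.kerProj_gradient_eq_zero {m p : ℕ} {a l : ℝ} {ι : Type*} [Fintype ι]
    {f : IOSpace m p → ℝ} (hf : StronglyConvexSmooth a l f) (hl : 0 < l)
    (M : Matrix ι (Fin m ⊕ Fin p) ℝ) {ζ : IOSpace m p} (hζ : M *ᵥ WithLp.ofLp ζ = 0)
    (hmin : ∀ z : IOSpace m p, M *ᵥ WithLp.ofLp z = 0 → f ζ ≤ f z) :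
    kerProj M (gradient f ζ) = 0 := by
  set v := kerProj M (gradient f ζ) with hv
  have h1 := hmin (ζ + (-(1 / l)) • v) (by
    rw [WithLp.ofLp_add, WithLp.ofLp_smul, Matrix.mulVec_add, Matrix.mulVec_smul, hζ, hv,
      mulVec_kerProj, smul_zero, add_zero])
  have h2 := hf.smooth (ζ + (-(1 / l)) • v) ζ
  rw [add_sub_cancel_left, inner_smul_right, norm_smul, mul_pow, Real.norm_eq_abs, sq_abs, hv,
    inner_kerProj_self, ← hv] at h2
  have h3 : 0 ≤ -(1 / l) * ‖v‖ ^ 2 + l / 2 * ((-(1 / l)) ^ 2 * ‖v‖ ^ 2) := by linarith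
  have e : -(1 / l) * ‖v‖ ^ 2 + l / 2 * ((-(1 / l)) ^ 2 * ‖v‖ ^ 2) = -(‖v‖ ^ 2 / (2 * l)) := by
    field_simp; ring
  rw [e] at h3
  by_contra hne
  have : 0 < ‖v‖ ^ 2 / (2 * l) := by have := norm_pos_iff.2 hne; positivity
  linarith

/-- The minimizer is a fixed point of the projected step, the projection is nonexpansive, and the
unprojected step contracts. -/
theorem StronglyConvexSmooth.norm_kerProj_step_le {m p : ℕ} {a l γ : ℝ} {ι : Type*} [Fintype ι]
    {f : IOSpace m p → ℝ} (hf : StronglyConvexSmooth a l f) (ha : 0 < a) (hl : 0 < l)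
    (hγ : 0 < γ) (hγ' : γ ≤ 2 / (a + l)) (M : Matrix ι (Fin m ⊕ Fin p) ℝ) {z ζ : IOSpace m p}
    (hz : M *ᵥ WithLp.ofLp z = 0) (hζ : M *ᵥ WithLp.ofLp ζ = 0)
    (hmin : ∀ z : IOSpace m p, M *ᵥ WithLp.ofLp z = 0 → f ζ ≤ f z) :
    ‖kerProj M (z - γ • gradient f z) - ζ‖ ≤ gradientRate a l γ * ‖z - ζ‖ := by
  have h := hf.kerProj_gradient_eq_zero hl M hζ hmin
  have e : kerProj M (z - γ • gradient f z) - ζ =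
      kerProj M ((z - ζ) - γ • (gradient f z - gradient f ζ)) := by
    simp only [map_sub, map_smul, h, sub_zero, kerProj_of_mulVec_eq_zero M hz,
      kerProj_of_mulVec_eq_zero M hζ]
    abel
  rw [e]
  exact (norm_kerProj_le M _).trans (hf.norm_gradient_step_le ha hl hγ hγ' ζ z)

/-! ### Schur stability -/

section schur

open Filter Topology

attribute [local instance] Matrix.linftyOpNormedRing Matrix.linftyOpNormedAlgebra

/-- Gelfand's formula: for `r` strictly between the spectral radius and 1, eventually `‖A ^ k‖ ≤ r ^
k`. The case `n = 0` is apart because there the spectrum is empty. -/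
theorem LTI.SchurStable.summable_norm_pow {n m p : ℕ} {sys : LTI n m p} (h : sys.SchurStable) :
    Summable fun k : ℕ => ‖sys.A ^ k‖ := by
  rcases Nat.eq_zero_or_pos n with rfl | hn
  · have : (fun k : ℕ => ‖sys.A ^ k‖) = fun _ => 0 := by
      funext k; rw [Subsingleton.elim (sys.A ^ k) 0, norm_zero]
    rw [this]; exact summable_zero
  have : Nonempty (Fin n) := ⟨⟨0, hn⟩⟩
  set A' : Matrix (Fin n) (Fin n) ℂ := sys.A.map (algebraMap ℝ ℂ) with hA'
  -- The row-sum norm is unchanged by passing to complex entries.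
  have hnorm : ∀ k : ℕ, ‖A' ^ k‖₊ = ‖sys.A ^ k‖₊ := by
    intro k
    have : A' ^ k = (sys.A ^ k).map (algebraMap ℝ ℂ) := by
      rw [hA']; exact (map_pow (algebraMap ℝ ℂ).mapMatrix sys.A k).symm
    rw [this, Matrix.linfty_opNNNorm_def, Matrix.linfty_opNNNorm_def]
    simp
  have h1 : spectralRadius ℂ A' < (1 : NNReal) :=
    spectrum.spectralRadius_lt_of_forall_lt A' (fun z hz => h z hz)
  obtain ⟨r, hr1, hr2⟩ := ENNReal.lt_iff_exists_nnreal_btwn.1 h1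
  have h2 := (spectrum.pow_nnnorm_pow_one_div_tendsto_nhds_spectralRadius A').eventually
    (gt_mem_nhds hr1)
  have hr : (r : ℝ) < 1 := by exact_mod_cast hr2
  have hg : Summable fun k : ℕ => (r : ℝ) ^ k :=
    summable_geometric_of_lt_one r.coe_nonneg hr
  refine hg.of_norm_bounded_eventually_nat ?_
  filter_upwards [h2, eventually_gt_atTop 0] with k hk hk0
  rw [norm_norm]
  have hk' : (k : ℝ) ≠ 0 := by exact_mod_cast hk0.ne'
  have h3 := ENNReal.rpow_le_rpow hk.le (Nat.cast_nonneg (α := ℝ) k)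
  rw [← ENNReal.rpow_mul, one_div, inv_mul_cancel₀ hk', ENNReal.rpow_one,
    ENNReal.rpow_natCast, hnorm] at h3
  exact_mod_cast h3

/-- A Lyapunov norm of a Schur stable system. -/
theorem LTI.SchurStable.exists_lyapunov {n m p : ℕ} {sys : LTI n m p} (h : sys.SchurStable) :
    ∃ (V : (Fin n → ℝ) → ℝ) (K : ℝ), 0 ≤ K ∧ (∀ x, 0 ≤ V x) ∧ (∀ x, V x ≤ K * ‖x‖) ∧
      (∀ x y, V (x + y) ≤ V x + V y) ∧ ∀ x, V (sys.A *ᵥ x) = V x - ‖x‖ := by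
  have hs := h.summable_norm_pow
  have hle : ∀ (x : Fin n → ℝ) (k : ℕ), ‖(sys.A ^ k) *ᵥ x‖ ≤ ‖sys.A ^ k‖ * ‖x‖ :=
    fun x k => Matrix.linfty_opNorm_mulVec _ _
  have hsum : ∀ x : Fin n → ℝ, Summable fun k : ℕ => ‖(sys.A ^ k) *ᵥ x‖ := fun x =>
    Summable.of_nonneg_of_le (fun _ => norm_nonneg _) (hle x) (hs.mul_right _)
  -- Summing the norms along the free response makes `V (A x) = V x - ‖x‖` a shift of the series.
  refine ⟨fun x => ∑' k : ℕ, ‖(sys.A ^ k) *ᵥ x‖, ∑' k : ℕ, ‖sys.A ^ k‖,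
    tsum_nonneg fun _ => norm_nonneg _, fun x => tsum_nonneg fun _ => norm_nonneg _, ?_, ?_, ?_⟩
  · intro x
    rw [← tsum_mul_right]
    exact (hsum x).tsum_le_tsum (hle x) (hs.mul_right _)
  · intro x y
    rw [← (hsum x).tsum_add (hsum y)]
    refine (hsum _).tsum_le_tsum (fun k => ?_) ((hsum x).add (hsum y))
    rw [Matrix.mulVec_add]; exact norm_add_le _ _
  · intro x
    change (∑' k : ℕ, ‖(sys.A ^ k) *ᵥ (sys.A *ᵥ x)‖) = (∑' k : ℕ, ‖(sys.A ^ k) *ᵥ x‖) - ‖x‖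
    rw [(hsum x).tsum_eq_zero_add]
    simp only [pow_zero, Matrix.one_mulVec, add_sub_cancel_left, pow_succ, Matrix.mulVec_mulVec]

end schur

/-- The states of a Schur stable system are summable against the disturbances, and a steady
state is bounded by the disturbance that maintains it. -/
theorem LTI.SchurStable.exists_gain {n m p : ℕ} {sys : LTI n m p} (h : sys.SchurStable) :
    ∃ K : ℝ, 0 ≤ K ∧ (∀ x w : ℕ → Fin n → ℝ, (∀ t, x (t + 1) = sys.A *ᵥ x t + w t) → ∀ T : ℕ,
      ∑ t ∈ Finset.range (T + 1), ‖x t‖ ≤ K * (‖x 0‖ + ∑ t ∈ Finset.range T, ‖w t‖)) ∧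
      ∀ x w : Fin n → ℝ, x = sys.A *ᵥ x + w → ‖x‖ ≤ K * ‖w‖ := by
  obtain ⟨V, K, hK, hV0, hVK, hVadd, hVA⟩ := h.exists_lyapunov
  refine ⟨K, hK, fun x w hx T => ?_, fun x w hx => ?_⟩
  · have key : ∀ T : ℕ, V (x T) + ∑ t ∈ Finset.range T, ‖x t‖ ≤
        K * (‖x 0‖ + ∑ t ∈ Finset.range T, ‖w t‖) := by
      intro T
      induction T with
      | zero => simpa using hVK (x 0)
      | succ T ih =>
        rw [Finset.sum_range_succ, Finset.sum_range_succ, hx T]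
        have h1 := hVadd (sys.A *ᵥ x T) (w T)
        rw [hVA] at h1
        have h2 := hVK (w T)
        nlinarith
    rw [Finset.sum_range_succ]
    linarith [key T, hV0 (sys.A *ᵥ x T), hVA (x T)]
  · have h1 := hVadd (sys.A *ᵥ x) w
    rw [← hx, hVA] at h1
    linarith [hVK w]

end DDOCO

namespace DDOCO

/-! ### Simulation of the system -/

/-- The state of the system after `k` steps from `x₀` with the inputs `u`. -/
def LTI.sim {n m p : ℕ} (sys : LTI n m p) (x₀ : Fin n → ℝ) (u : ℕ → Fin m → ℝ) :
    ℕ → Fin n → ℝ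
  | 0 => x₀
  | k + 1 => sys.A *ᵥ LTI.sim sys x₀ u k + sys.B *ᵥ u k

namespace LTI

variable {n m p : ℕ} (sys : LTI n m p)

theorem eq_sim {x : ℕ → Fin n → ℝ} {u : ℕ → Fin m → ℝ} {x₀ : Fin n → ℝ} {K : ℕ} (h0 : x 0 = x₀)
    (h : ∀ k < K, x (k + 1) = sys.A *ᵥ x k + sys.B *ᵥ u k) {k : ℕ} (hk : k ≤ K) :
    x k = sys.sim x₀ u k := by
  induction k with
  | zero => exact h0
  | succ k ih => rw [h k hk, ih (Nat.le_of_succ_le hk)]; rfl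

theorem sim_eq (x₀ : Fin n → ℝ) (u : ℕ → Fin m → ℝ) (k : ℕ) :
    sys.sim x₀ u k = sys.A ^ k *ᵥ x₀ +
      ∑ i ∈ Finset.range k, (sys.A ^ i * sys.B) *ᵥ u (k - 1 - i) := by
  induction k with
  | zero => simp [sim]
  | succ k ih =>
    rw [sim, ih, Finset.sum_range_succ', Matrix.mulVec_add, Matrix.mulVec_mulVec, ← pow_succ',
      Matrix.mulVec_sum, add_assoc]
    simp only [Matrix.mulVec_mulVec, ← Matrix.mul_assoc, ← pow_succ', pow_zero, Matrix.one_mul,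
      add_tsub_cancel_right, tsub_zero]
    congr 2
    refine Finset.sum_congr rfl fun i _ => ?_
    rw [Nat.sub_sub, add_comm 1 i]

theorem sim_add (x₀ : Fin n → ℝ) (u : ℕ → Fin m → ℝ) (i k : ℕ) :
    sys.sim x₀ u (i + k) = sys.sim (sys.sim x₀ u i) (fun j => u (i + j)) k := by
  induction k with
  | zero => rfl
  | succ k ih => rw [← add_assoc, sim, ih]; rfl

theorem sim_congr {x₀ : Fin n → ℝ} {u v : ℕ → Fin m → ℝ} {k : ℕ} (h : ∀ j < k, u j = v j) :
    sys.sim x₀ u k = sys.sim x₀ v k := by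
  induction k with
  | zero => rfl
  | succ k ih => rw [sim, sim, ih fun j hj => h j (by omega), h k (by omega)]

theorem sim_zero {u : ℕ → Fin m → ℝ} {k : ℕ} (h : ∀ j < k, u j = 0) :
    sys.sim 0 u k = 0 := by
  induction k with
  | zero => rfl
  | succ k ih => rw [sim, ih fun j hj => h j (by omega), h k (by omega)]; simp

theorem sim_sub (x₀ x₁ : Fin n → ℝ) (u : ℕ → Fin m → ℝ) (k : ℕ) :
    sys.sim x₀ u k - sys.sim x₁ u k = sys.A ^ k *ᵥ (x₀ - x₁) := by
  rw [sim_eq, sim_eq, Matrix.mulVec_sub]; abel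

/-! ### Controllability and observability -/

theorem ctrbMatrix_mulVec (k : ℕ) (q : Fin k × Fin m → ℝ) :
    sys.ctrbMatrix k *ᵥ q = ∑ i : Fin k, (sys.A ^ (i : ℕ) * sys.B) *ᵥ fun c => q (i, c) := by
  ext a
  simp only [Matrix.mulVec, dotProduct, ctrbMatrix, Matrix.of_apply, Finset.sum_apply,
    Fintype.sum_prod_type]

theorem range_ctrbMatrix_mono {k l : ℕ} (h : k ≤ l) :
    LinearMap.range (sys.ctrbMatrix k).mulVecLin ≤ LinearMap.range (sys.ctrbMatrix l).mulVecLin := by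
  rw [Matrix.range_mulVecLin, Matrix.range_mulVecLin]
  apply Submodule.span_mono
  rintro _ ⟨⟨i, c⟩, rfl⟩
  exact ⟨(Fin.castLE h i, c), rfl⟩

theorem Controllable.rank_ctrbMatrix {sys : LTI n m p} (h : sys.Controllable) {k : ℕ}
    (hk : sys.ctrbIndex ≤ k) : (sys.ctrbMatrix k).rank = n := by
  have h1 : (sys.ctrbMatrix sys.ctrbIndex).rank = n := Nat.sInf_mem (⟨n, h⟩ : Set.Nonempty
    {k : ℕ | (sys.ctrbMatrix k).rank = n})
  apply le_antisymm
  · simpa using (sys.ctrbMatrix k).rank_le_card_height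
  · conv_lhs => rw [← h1]
    exact Submodule.finrank_mono (sys.range_ctrbMatrix_mono hk)

theorem exists_sim_eq {k : ℕ} (h : (sys.ctrbMatrix k).rank = n) (x₀ x : Fin n → ℝ) :
    ∃ v : ℕ → Fin m → ℝ, sys.sim x₀ v k = x := by
  obtain ⟨q, hq⟩ := mulVec_surjective_of_rank (M := sys.ctrbMatrix k) (by simpa using h)
    (x - sys.A ^ k *ᵥ x₀)
  -- The input at time `j` reaches the state at time `k` through `A ^ (k - 1 - j) B`, so the blocks
  -- of `q` are fed in reverse order.
  refine ⟨fun j c => if hj : k - 1 - j < k then q (⟨k - 1 - j, hj⟩, c) else 0, ?_⟩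
  rw [sim_eq]
  refine eq_sub_iff_add_eq'.1 ?_
  rw [← hq, ctrbMatrix_mulVec, Finset.sum_range]
  refine Finset.sum_congr rfl fun i _ => ?_
  congr 1
  funext c
  have hi : k - 1 - (k - 1 - (i : ℕ)) = i := by have := i.2; omega
  simp only [hi, i.2, dite_true, Fin.eta]

/-- The first `n` outputs of the autonomous system determine the initial state. -/
theorem Observable.exists_bound {sys : LTI n m p} (h : sys.Observable) :
    ∃ c : ℝ, 0 ≤ c ∧ ∀ x : Fin n → ℝ, ∀ w : Fin n → Fin p → ℝ,
      (∀ k : Fin n, sys.C *ᵥ (sys.A ^ (k : ℕ) *ᵥ x) = w k) → ‖x‖ ≤ c * ‖stack w‖ := by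
  obtain ⟨G, hG⟩ := exists_mul_eq_one_of_rank (M := sys.obsvMatrix)
    (h.trans (Fintype.card_fin n).symm)
  obtain ⟨c, hc, hb⟩ := exists_norm_mulVec_le G
  refine ⟨c, hc, fun x w hx => ?_⟩
  have h1 : sys.obsvMatrix *ᵥ x = stack w := by
    funext q
    have := congrFun (hx q.1) q.2
    rw [Matrix.mulVec_mulVec] at this
    exact this
  have h2 : x = G *ᵥ stack w := by
    rw [← h1, Matrix.mulVec_mulVec, hG, Matrix.one_mulVec]
  conv_lhs => rw [h2]
  exact hb _

/-- The difference of the two trajectories is a free response with `n` zero outputs, hence zero.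
This is how windows of samples are converted into states. -/
theorem Observable.eq_of_outputs_eq {sys : LTI n m p} (h : sys.Observable)
    {x x' : ℕ → Fin n → ℝ} {u u' : ℕ → Fin m → ℝ} {y y' : ℕ → Fin p → ℝ}
    (hx : ∀ k < n, x (k + 1) = sys.A *ᵥ x k + sys.B *ᵥ u k ∧ y k = sys.C *ᵥ x k + sys.D *ᵥ u k)
    (hx' : ∀ k < n, x' (k + 1) = sys.A *ᵥ x' k + sys.B *ᵥ u' k ∧
      y' k = sys.C *ᵥ x' k + sys.D *ᵥ u' k)
    (hu : ∀ k < n, u k = u' k) (hy : ∀ k < n, y k = y' k) : ∀ k ≤ n, x k = x' k := by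
  have e : ∀ k ≤ n, x k = sys.sim (x 0) u k := fun k hk =>
    sys.eq_sim rfl (fun k hk => (hx k hk).1) hk
  have e' : ∀ k ≤ n, x' k = sys.sim (x' 0) u k := fun k hk =>
    (sys.eq_sim rfl (fun k hk => (hx' k hk).1) hk).trans
      (sys.sim_congr fun j hj => (hu j (hj.trans_le hk)).symm)
  obtain ⟨c, -, hb⟩ := h.exists_bound
  have h0 : x 0 - x' 0 = 0 := by
    have h1 := hb (x 0 - x' 0) 0 (fun k => by
      have h2 := hy k k.2
      rw [(hx k k.2).2, (hx' k k.2).2, hu k k.2, add_left_inj, e k k.2.le, e' k k.2.le] at h2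
      rw [← sim_sub, Matrix.mulVec_sub, h2, sub_self]; rfl)
    have h3 : stack (0 : Fin n → Fin p → ℝ) = 0 := rfl
    rw [h3, norm_zero, mul_zero] at h1
    exact norm_le_zero_iff.1 h1
  intro k hk
  rw [e k hk, e' k hk, sub_eq_zero.1 h0]

end LTI

/-! ### Combinations of windows of a sequence -/

/-- A finite sequence extended by zero. -/
def extend {N q : ℕ} (w : Fin N → Fin q → ℝ) : ℕ → Fin q → ℝ :=
  fun k => if h : k < N then w ⟨k, h⟩ else 0

theorem extend_apply {N q : ℕ} (w : Fin N → Fin q → ℝ) (k : Fin N) : extend w k = w k := by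
  simp [extend]

/-- The combination of the shifts of a sequence with coefficients `g`. -/
def comb {K q : ℕ} (g : Fin K → ℝ) (w : ℕ → Fin q → ℝ) (i : ℕ) : Fin q → ℝ :=
  ∑ j : Fin K, g j • w (j + i)

theorem comb_add {K q : ℕ} (g h : Fin K → ℝ) (w : ℕ → Fin q → ℝ) (i : ℕ) :
    comb (g + h) w i = comb g w i + comb h w i := by
  simp only [comb, Pi.add_apply, add_smul, Finset.sum_add_distrib]

theorem hankel_mulVec {N q : ℕ} (w : Fin N → Fin q → ℝ) (L : ℕ) (g : Fin (N + 1 - L) → ℝ)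
    (i : Fin L) (c : Fin q) : (hankel w L *ᵥ g) (i, c) = comb g (extend w) i c := by
  simp only [Matrix.mulVec, dotProduct, comb, Finset.sum_apply, hankel, Matrix.of_apply,
    Pi.smul_apply, smul_eq_mul]
  refine Finset.sum_congr rfl fun j _ => ?_
  have h : (j : ℕ) + i < N := by have := i.2; have := j.2; omega
  rw [mul_comm, extend, dif_pos h]
  simp only [add_comm]

/-! ### Trajectories generated by the data, and the fundamental lemma -/

namespace LTI

variable {n m p N : ℕ}

/-- `x` is a state sequence of the data. -/
def IsStateOf (sys : LTI n m p) (ud : Fin N → Fin m → ℝ) (yd : Fin N → Fin p → ℝ)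
    (x : ℕ → Fin n → ℝ) : Prop :=
  ∀ k < N, x (k + 1) = sys.A *ᵥ x k + sys.B *ᵥ extend ud k ∧
    extend yd k = sys.C *ᵥ x k + sys.D *ᵥ extend ud k

theorem IsTrajectory.exists_isStateOf {sys : LTI n m p} {ud : Fin N → Fin m → ℝ}
    {yd : Fin N → Fin p → ℝ} (h : sys.IsTrajectory ud yd) : ∃ x, sys.IsStateOf ud yd x := by
  obtain ⟨x, hx⟩ := h
  refine ⟨x, fun k hk => ?_⟩
  have := hx ⟨k, hk⟩
  rw [← extend_apply ud, ← extend_apply yd] at this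
  exact this

variable {sys : LTI n m p} {ud : Fin N → Fin m → ℝ} {yd : Fin N → Fin p → ℝ} {x : ℕ → Fin n → ℝ}

/-- Linearity and time invariance; `i < L` keeps all indices `j + i` inside the data. -/
theorem IsStateOf.comb (h : sys.IsStateOf ud yd x) {L : ℕ} (g : Fin (N + 1 - L) → ℝ) {i : ℕ}
    (hi : i < L) : DDOCO.comb g x (i + 1) =
        sys.A *ᵥ DDOCO.comb g x i + sys.B *ᵥ DDOCO.comb g (extend ud) i ∧
      DDOCO.comb g (extend yd) i =
        sys.C *ᵥ DDOCO.comb g x i + sys.D *ᵥ DDOCO.comb g (extend ud) i := by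
  have hlt : ∀ j : Fin (N + 1 - L), (j : ℕ) + i < N := fun j => by have := j.2; omega
  simp only [DDOCO.comb, Matrix.mulVec_sum, Matrix.mulVec_smul, ← Finset.sum_add_distrib,
    ← smul_add]
  exact ⟨Finset.sum_congr rfl fun j _ => by rw [← add_assoc, (h _ (hlt j)).1],
    Finset.sum_congr rfl fun j _ => by rw [(h _ (hlt j)).2]⟩

/-- A linear functional of the state and the following `L` inputs that vanishes on the data
satisfies the recurrence of the characteristic polynomial along all trajectories. -/
theorem charpoly_recurrence (h : sys.IsStateOf ud yd x) {L L' : ℕ} (hL : L + n ≤ L')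
    (hpe : PersistentlyExciting ud L')
    (f : ((Fin n → ℝ) × (Fin L → Fin m → ℝ)) →ₗ[ℝ] ℝ)
    (hf : ∀ j < N + 1 - L, f (x j, fun l => extend ud (j + l)) = 0)
    (x₀ : Fin n → ℝ) (u : ℕ → Fin m → ℝ) :
    ∑ k ∈ Finset.range (n + 1),
      sys.A.charpoly.coeff k * f (sys.sim x₀ u k, fun l => u (k + l)) = 0 := by
  obtain ⟨g, hg⟩ := mulVec_surjective_of_rank (M := hankel ud L')
    (by rw [hpe]; simp [mul_comm]) (stack fun l : Fin L' => u l)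
  have hu : ∀ i < L', comb g (extend ud) i = u i := by
    intro i hi
    funext c
    have := congrFun hg (⟨i, hi⟩, c)
    rwa [hankel_mulVec] at this
  have hsim : ∀ k ≤ n, comb g x k = sys.sim (comb g x 0) u k := by
    intro k hk
    refine sys.eq_sim rfl (fun i hi => ?_) hk
    rw [← hu i (by omega)]
    exact (h.comb g (by omega : i < L')).1
  have h1 : ∀ k ≤ n, f (sys.sim (comb g x 0) u k, fun l => u (k + l)) = 0 := by
    intro k hk
    have e : (sys.sim (comb g x 0) u k, fun l : Fin L => u (k + l)) =
        ∑ j : Fin (N + 1 - L'), g j • (x (j + k), fun l : Fin L => extend ud (j + k + l)) := by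
      rw [Prod.ext_iff, Prod.fst_sum, Prod.snd_sum]
      refine ⟨(hsim k hk).symm, ?_⟩
      funext l
      rw [Finset.sum_apply]
      change u (k + l) = _
      rw [← hu (k + l) (by have := l.2; omega)]
      refine Finset.sum_congr rfl fun j _ => ?_
      rw [← add_assoc]; rfl
    rw [e, map_sum]
    refine Finset.sum_eq_zero fun j _ => ?_
    rw [map_smul, hf _ (by have := j.2; omega), smul_zero]
  -- The two trajectories share their input, so only a free response remains, and Cayley-Hamilton
  -- annihilates it.
  have h2 : ∀ k ≤ n, f (sys.sim x₀ u k, fun l => u (k + l)) =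
      f (sys.A ^ k *ᵥ (x₀ - comb g x 0), 0) := by
    intro k hk
    rw [← sub_zero (f (sys.sim x₀ u k, fun l => u (k + l))), ← h1 k hk, ← map_sub,
      Prod.mk_sub_mk, sim_sub, sub_self]
  have h3 : ∀ k ∈ Finset.range (n + 1), sys.A.charpoly.coeff k *
      f (sys.sim x₀ u k, fun l => u (k + l)) =
      f (sys.A.charpoly.coeff k • (sys.A ^ k *ᵥ (x₀ - comb g x 0)), 0) := by
    intro k hk
    rw [h2 k (by have := Finset.mem_range.1 hk; omega), ← smul_eq_mul, ← map_smul]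
    simp
  have hdeg : sys.A.charpoly.natDegree = n := by
    rw [Matrix.charpoly_natDegree_eq_dim, Fintype.card_fin]
  have h4 := Matrix.aeval_self_charpoly sys.A
  rw [Polynomial.aeval_eq_sum_range, hdeg] at h4
  rw [Finset.sum_congr rfl h3, ← map_sum]
  have h5 : ∑ k ∈ Finset.range (n + 1),
      ((sys.A.charpoly.coeff k • (sys.A ^ k *ᵥ (x₀ - comb g x 0)), 0) :
        (Fin n → ℝ) × (Fin L → Fin m → ℝ)) = 0 := by
    rw [Prod.ext_iff, Prod.fst_sum, Prod.snd_sum]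
    refine ⟨?_, by simp⟩
    simp only [← Matrix.smul_mulVec]
    rw [← Matrix.sum_mulVec, h4, Matrix.zero_mulVec]; rfl
  rw [h5, map_zero]

/-- The **fundamental lemma** of Willems et al.: for persistently exciting data, every initial
state and input sequence is a combination of those of the data. -/
theorem exists_comb_eq (h : sys.IsStateOf ud yd x) (hc : sys.Controllable) {L L' : ℕ}
    (hL : L + n ≤ L') (hpe : PersistentlyExciting ud L') (x₀ : Fin n → ℝ)
    (u : ℕ → Fin m → ℝ) :
    ∃ g : Fin (N + 1 - L) → ℝ, comb g x 0 = x₀ ∧ ∀ i < L, comb g (extend ud) i = u i := by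
  set W : Submodule ℝ ((Fin n → ℝ) × (Fin L → Fin m → ℝ)) := Submodule.span ℝ
    (Set.range fun j : Fin (N + 1 - L) => (x j, fun l : Fin L => extend ud (j + l))) with hW
  have hmem : (x₀, fun l : Fin L => u l) ∈ W := by
    by_contra hne
    obtain ⟨f, hf1, hf2⟩ := Submodule.exists_dual_map_eq_bot_of_notMem hne inferInstance
    apply hf1
    have hf : ∀ j < N + 1 - L, f (x j, fun l => extend ud (j + l)) = 0 := by
      intro j hj
      have : f (x j, fun l => extend ud (j + l)) ∈ W.map f :=
        Submodule.mem_map_of_mem (Submodule.subset_span ⟨⟨j, hj⟩, rfl⟩)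
      rwa [hf2, Submodule.mem_bot] at this
    obtain ⟨v, hv⟩ := sys.exists_sim_eq hc 0 x₀
    -- Rest at zero for `n + L` steps, steering to `x₀` in `n` steps, then `u`. The first `n` values
    -- of `s` vanish at rest, the monic recurrence propagates the zeros, and the value at `n + L +
    -- n` is the wanted `f (x₀, u)`.
    set w : ℕ → Fin m → ℝ := fun j =>
      if j < n + L then 0 else if j < n + L + n then v (j - (n + L)) else u (j - (n + L + n))
      with hw
    set s : ℕ → ℝ := fun i => f (sys.sim 0 w i, fun l => w (i + l)) with hs
    have hrec : ∀ i, ∑ k ∈ Finset.range (n + 1), sys.A.charpoly.coeff k * s (i + k) = 0 := by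
      intro i
      have := charpoly_recurrence h hL hpe f hf (sys.sim 0 w i) (fun j => w (i + j))
      simpa only [← sim_add, ← add_assoc] using this
    have hlead : sys.A.charpoly.coeff n = 1 := by
      have := sys.A.charpoly_monic.coeff_natDegree
      rwa [Matrix.charpoly_natDegree_eq_dim, Fintype.card_fin] at this
    have hzero : ∀ i, s i = 0 := by
      intro i
      induction i using Nat.strong_induction_on with
      | _ i ih =>
        by_cases hi : i < n
        · have h1 : sys.sim 0 w i = 0 :=
            sys.sim_zero fun j hj => if_pos (by omega)
          have h2 : (fun l : Fin L => w (i + l)) = 0 := by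
            funext l; exact if_pos (by have := l.2; omega)
          simp only [hs, h1, h2]
          exact map_zero f
        · have h1 := hrec (i - n)
          rw [Finset.sum_range_succ, hlead, one_mul, Nat.sub_add_cancel (not_lt.1 hi),
            Finset.sum_eq_zero, zero_add] at h1
          · exact h1
          · intro k hk
            rw [ih _ (by have := Finset.mem_range.1 hk; omega), mul_zero]
    have h1 : sys.sim 0 w (n + L + n) = x₀ := by
      rw [sim_add, sys.sim_zero fun j hj => if_pos hj, ← hv]
      refine sys.sim_congr fun j hj => ?_
      simp only [hw]
      rw [if_neg (by omega), if_pos (by omega), Nat.add_sub_cancel_left]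
    have h2 : (fun l : Fin L => w (n + L + n + l)) = fun l : Fin L => u l := by
      funext l
      simp only [hw]
      rw [if_neg (by omega), if_neg (by omega), Nat.add_sub_cancel_left]
    have h3 := hzero (n + L + n)
    simp only [hs, h1, h2] at h3
    exact h3
  rw [hW, Submodule.mem_span_range_iff_exists_fun] at hmem
  obtain ⟨g, hg⟩ := hmem
  rw [Prod.ext_iff, Prod.fst_sum, Prod.snd_sum] at hg
  refine ⟨g, hg.1, fun i hi => ?_⟩
  have := congrFun hg.2 ⟨i, hi⟩
  rw [Finset.sum_apply] at this
  exact this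

end LTI

end DDOCO

namespace DDOCO

/-! ### Input-output pairs -/

theorem norm_inPart_le {m p : ℕ} (z : IOSpace m p) : ‖inPart z‖ ≤ ‖z‖ :=
  (pi_norm_le_iff_of_nonneg (norm_nonneg z)).2 fun i => PiLp.norm_apply_le z (Sum.inl i)

theorem ioPair_inPart_outPart {m p : ℕ} (z : IOSpace m p) : ioPair (inPart z) (outPart z) = z := by
  ext i; cases i <;> rfl

/-- Plain vectors carry the sup norm, whereas `IOSpace` is Euclidean. -/
theorem exists_norm_ioPair_le (m p : ℕ) : ∃ c : ℝ, 0 ≤ c ∧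
    ∀ (u : Fin m → ℝ) (y : Fin p → ℝ), ‖ioPair u y‖ ≤ c * (‖u‖ + ‖y‖) := by
  set e := (PiLp.continuousLinearEquiv 2 ℝ (fun _ : Fin m ⊕ Fin p => ℝ)).symm
  refine ⟨‖(e : (Fin m ⊕ Fin p → ℝ) →L[ℝ] IOSpace m p)‖, norm_nonneg _, fun u y => ?_⟩
  refine ((e : (Fin m ⊕ Fin p → ℝ) →L[ℝ] IOSpace m p).le_opNorm (Sum.elim u y)).trans ?_
  refine mul_le_mul_of_nonneg_left ?_ (norm_nonneg _)
  refine (pi_norm_le_iff_of_nonneg (by positivity)).2 fun i => ?_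
  cases i with
  | inl i => exact (norm_le_pi_norm u i).trans (le_add_of_nonneg_right (norm_nonneg _))
  | inr i => exact (norm_le_pi_norm y i).trans (le_add_of_nonneg_left (norm_nonneg _))

/-- A steady state is kept by its constant input. -/
theorem LTI.eq_steadyState {n m p : ℕ} (sys : LTI n m p) {x : ℕ → Fin n → ℝ}
    {u : ℕ → Fin m → ℝ} {xs : Fin n → ℝ} {us : Fin m → ℝ} (hs : xs = sys.A *ᵥ xs + sys.B *ᵥ us)
    {K : ℕ} (h0 : x 0 = xs) (h : ∀ k < K, x (k + 1) = sys.A *ᵥ x k + sys.B *ᵥ u k)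
    (hu : ∀ k < K, u k = us) {k : ℕ} (hk : k ≤ K) : x k = xs := by
  induction k with
  | zero => exact h0
  | succ k ih => rw [h k hk, ih (Nat.le_of_succ_le hk), hu k hk, ← hs]

/-! ### The linear equations of the algorithm as statements about combined trajectories -/

namespace AlgParams

variable {n m p μ N r : ℕ} (P : AlgParams n m p μ N r)

theorem blockRows_U_mulVec (g : Fin (N + 1 - (2 * n + μ + 1)) → ℝ) (a k : ℕ)
    (h : a + k ≤ 2 * n + μ + 1) (i : Fin k) (c : Fin m) :
    (blockRows P.U a k h *ᵥ g) (i, c) = comb g (extend P.ud) (a + i) c :=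
  hankel_mulVec P.ud (2 * n + μ + 1) g ⟨a + i, by have := i.2; omega⟩ c

theorem blockRows_Y_mulVec (g : Fin (N + 1 - (2 * n + μ + 1)) → ℝ) (a k : ℕ)
    (h : a + k ≤ 2 * n + μ + 1) (i : Fin k) (c : Fin p) :
    (blockRows P.Y a k h *ᵥ g) (i, c) = comb g (extend P.yd) (a + i) c :=
  hankel_mulVec P.yd (2 * n + μ + 1) g ⟨a + i, by have := i.2; omega⟩ c

theorem blockRow_U_mulVec (g : Fin (N + 1 - (2 * n + μ + 1)) → ℝ) (a : ℕ)
    (h : a < 2 * n + μ + 1) : blockRow P.U a h *ᵥ g = comb g (extend P.ud) a :=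
  funext fun c => hankel_mulVec P.ud (2 * n + μ + 1) g ⟨a, h⟩ c

theorem blockRow_Y_mulVec (g : Fin (N + 1 - (2 * n + μ + 1)) → ℝ) (a : ℕ)
    (h : a < 2 * n + μ + 1) : blockRow P.Y a h *ᵥ g = comb g (extend P.yd) a :=
  funext fun c => hankel_mulVec P.yd (2 * n + μ + 1) g ⟨a, h⟩ c

theorem Hα_mulVec_eq {a : Fin (N + 1 - (2 * n + μ + 1)) → ℝ} {w : Fin n → Fin m → ℝ}
    {v : Fin μ → Fin m → ℝ} {us : Fin m → ℝ} {yw : Fin n → Fin p → ℝ}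
    (h : P.Hα *ᵥ a = Sum.elim (stack w) (Sum.elim (Sum.elim (stack v) (repeated (n + 1) us))
      (stack yw))) :
    (∀ i : Fin n, comb a (extend P.ud) i = w i) ∧
    (∀ i : Fin μ, comb a (extend P.ud) (n + i) = v i) ∧
    (∀ i < n + 1, comb a (extend P.ud) (n + μ + i) = us) ∧
    ∀ i : Fin n, comb a (extend P.yd) i = yw i := by
  rw [Hα, Matrix.fromRows_mulVec, Matrix.fromRows_mulVec, Matrix.fromRows_mulVec] at h
  refine ⟨fun i => ?_, fun i => ?_, fun i hi => ?_, fun i => ?_⟩ <;> funext c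
  · have := congrFun h (Sum.inl (i, c))
    rw [Sum.elim_inl, blockRows_U_mulVec, zero_add] at this
    exact this
  · have := congrFun h (Sum.inr (Sum.inl (Sum.inl (i, c))))
    rw [Sum.elim_inr, Sum.elim_inl, Sum.elim_inl, blockRows_U_mulVec] at this
    exact this
  · have := congrFun h (Sum.inr (Sum.inl (Sum.inr (⟨i, hi⟩, c))))
    rw [Sum.elim_inr, Sum.elim_inl, Sum.elim_inr, blockRows_U_mulVec] at this
    exact this
  · have := congrFun h (Sum.inr (Sum.inr (i, c)))
    rw [Sum.elim_inr, Sum.elim_inr, blockRows_Y_mulVec, zero_add] at this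
    exact this

theorem gVec_eq {zs : IOSpace m p} {a : Fin (N + 1 - (2 * n + μ + 1)) → ℝ}
    {b : ℕ → Fin m → ℝ} {d : ℕ → Fin p → ℝ}
    (hb : ∀ i < n + 1, comb a (extend P.ud) (n + μ + i) = b i)
    (hd : ∀ i < n, comb a (extend P.yd) (n + μ + i) = d i) :
    P.gVec zs a = Sum.elim (0 : Fin n × Fin m → ℝ)
      (Sum.elim (stack fun i : Fin (n + 1) => inPart zs - b i)
        (Sum.elim (0 : Fin n × Fin p → ℝ) (stack fun i : Fin n => outPart zs - d i))) := by
  funext q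
  rcases q with q | ⟨i, c⟩ | q | ⟨i, c⟩
  · rfl
  · simp only [gVec, Sum.elim_inr, Sum.elim_inl, Pi.sub_apply, blockRows_U_mulVec, stack, repeated,
      hb i i.2]
  · rfl
  · simp only [gVec, Sum.elim_inr, Pi.sub_apply, blockRows_Y_mulVec, stack, repeated, hd i i.2]

theorem Hβ_mulVec_eq_gVec_iff (zs : IOSpace m p) (a b : Fin (N + 1 - (2 * n + μ + 1)) → ℝ) :
    P.Hβ *ᵥ b = P.gVec zs a ↔
      (∀ i < n, comb b (extend P.ud) i = 0) ∧
      (∀ i < n + 1, comb (a + b) (extend P.ud) (n + μ + i) = inPart zs) ∧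
      (∀ i < n, comb b (extend P.yd) i = 0) ∧
      ∀ i < n, comb (a + b) (extend P.yd) (n + μ + i) = outPart zs := by
  rw [gVec_eq P (fun i _ => rfl) (fun i _ => rfl), Hβ, Matrix.fromRows_mulVec,
    Matrix.fromRows_mulVec, Matrix.fromRows_mulVec]
  constructor
  · intro h
    refine ⟨fun i hi => ?_, fun i hi => ?_, fun i hi => ?_, fun i hi => ?_⟩ <;> funext c
    · have := congrFun h (Sum.inl (⟨i, hi⟩, c))
      rw [Sum.elim_inl, blockRows_U_mulVec, zero_add] at this
      exact this
    · have := congrFun h (Sum.inr (Sum.inl (⟨i, hi⟩, c)))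
      rw [Sum.elim_inr, Sum.elim_inl, blockRows_U_mulVec] at this
      rw [comb_add]
      exact eq_sub_iff_add_eq'.1 this
    · have := congrFun h (Sum.inr (Sum.inr (Sum.inl (⟨i, hi⟩, c))))
      rw [Sum.elim_inr, Sum.elim_inr, Sum.elim_inl, blockRows_Y_mulVec, zero_add] at this
      exact this
    · have := congrFun h (Sum.inr (Sum.inr (Sum.inr (⟨i, hi⟩, c))))
      rw [Sum.elim_inr, Sum.elim_inr, Sum.elim_inr, blockRows_Y_mulVec] at this
      rw [comb_add]
      exact eq_sub_iff_add_eq'.1 this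
  · rintro ⟨h1, h2, h3, h4⟩
    funext q
    rcases q with ⟨i, c⟩ | ⟨i, c⟩ | ⟨i, c⟩ | ⟨i, c⟩
    · rw [Sum.elim_inl, blockRows_U_mulVec, zero_add, h1 i i.2]; rfl
    · rw [Sum.elim_inr, Sum.elim_inl, blockRows_U_mulVec]
      have := h2 i i.2
      rw [comb_add] at this
      exact congrFun (eq_sub_iff_add_eq'.2 this) c
    · rw [Sum.elim_inr, Sum.elim_inr, Sum.elim_inl, blockRows_Y_mulVec, zero_add, h3 i i.2]; rfl
    · rw [Sum.elim_inr, Sum.elim_inr, Sum.elim_inr, blockRows_Y_mulVec]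
      have := h4 i i.2
      rw [comb_add] at this
      exact congrFun (eq_sub_iff_add_eq'.2 this) c

theorem S_mulVec (z : IOSpace m p) :
    P.S *ᵥ WithLp.ofLp z = P.Hss *ᵥ (pinv P.Hss *ᵥ
      Sum.elim (repeated (n + 1) (inPart z)) (repeated (n + 1) (outPart z))) -
      Sum.elim (repeated (n + 1) (inPart z)) (repeated (n + 1) (outPart z)) := by
  have h : ∀ (k q : ℕ) (v : Fin q → ℝ), repeatedId k q *ᵥ v = repeated k v := by
    intro k q v
    funext i
    simp [repeatedId, repeated, Matrix.mulVec, dotProduct]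
  have h2 : WithLp.ofLp z = Sum.elim (inPart z) (outPart z) := by
    funext i; cases i <;> rfl
  rw [S, ← Matrix.mulVec_mulVec, h2, Matrix.fromBlocks_mulVec]
  simp only [Sum.elim_comp_inl, Sum.elim_comp_inr, h, Matrix.zero_mulVec, add_zero, zero_add]
  rw [Matrix.sub_mulVec, Matrix.one_mulVec, Matrix.mulVec_mulVec]

theorem Hss_mulVec_eq_iff (g : Fin (N + 1 - (n + 1)) → ℝ) (u : Fin m → ℝ) (y : Fin p → ℝ) :
    P.Hss *ᵥ g = Sum.elim (repeated (n + 1) u) (repeated (n + 1) y) ↔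
      (∀ i < n + 1, comb g (extend P.ud) i = u) ∧ ∀ i < n + 1, comb g (extend P.yd) i = y := by
  rw [Hss, Matrix.fromRows_mulVec]
  constructor
  · intro h
    refine ⟨fun i hi => ?_, fun i hi => ?_⟩ <;> funext c
    · have := congrFun h (Sum.inl (⟨i, hi⟩, c))
      rwa [Sum.elim_inl, hankel_mulVec] at this
    · have := congrFun h (Sum.inr (⟨i, hi⟩, c))
      rwa [Sum.elim_inr, hankel_mulVec] at this
  · rintro ⟨h1, h2⟩
    funext q
    rcases q with ⟨i, c⟩ | ⟨i, c⟩
    · rw [Sum.elim_inl, hankel_mulVec, h1 i i.2]; rfl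
    · rw [Sum.elim_inr, hankel_mulVec, h2 i i.2]; rfl

variable {P} {sys : LTI n m p} {x : ℕ → Fin n → ℝ}

/-- Since `H H†` projects onto the column space, `S z = 0` says that the constant sequence `z` is
generated by the data. -/
theorem S_mulVec_eq_zero_iff (hx : sys.IsStateOf P.ud P.yd x) (hc : sys.Controllable)
    (ho : sys.Observable) (hpe : PersistentlyExciting P.ud (3 * n + μ + 1)) (z : IOSpace m p) :
    P.S *ᵥ WithLp.ofLp z = 0 ↔ z ∈ sys.steadyStates := by
  rw [S_mulVec, sub_eq_zero]
  constructor
  · intro h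
    obtain ⟨hu, hy⟩ := (P.Hss_mulVec_eq_iff _ _ _).1 h
    set g := pinv P.Hss *ᵥ
      Sum.elim (repeated (n + 1) (inPart z)) (repeated (n + 1) (outPart z))
    -- The constant sequence and its shift agree on `n` samples, hence in state; this uses the depth
    -- `n + 1`.
    have h0 : comb g x 0 = comb g x 1 :=
      ho.eq_of_outputs_eq (x := comb g x) (x' := fun k => comb g x (k + 1))
        (u' := fun k => comb g (extend P.ud) (k + 1)) (y' := fun k => comb g (extend P.yd) (k + 1))
        (fun k hk => hx.comb g (hk.trans_le n.le_succ))
        (fun k hk => hx.comb g (Nat.succ_lt_succ hk))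
        (fun k hk => (hu k (by omega)).trans (hu (k + 1) (by omega)).symm)
        (fun k hk => (hy k (by omega)).trans (hy (k + 1) (by omega)).symm) 0 n.zero_le
    have h1 := hx.comb g n.succ_pos
    rw [hu 0 n.succ_pos, hy 0 n.succ_pos, zero_add, ← h0] at h1
    exact ⟨_, h1⟩
  · rintro ⟨xs, hs, hys⟩
    obtain ⟨g, hg0, hgu⟩ := LTI.exists_comb_eq hx hc (L := n + 1) (by omega) hpe xs
      fun _ => inPart z
    have hgx : ∀ i ≤ n, comb g x i = xs := fun i hi =>
      sys.eq_steadyState hs hg0 (fun k hk => (hx.comb g (hk.trans_le n.le_succ)).1)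
        (fun k hk => hgu k (hk.trans_le n.le_succ)) hi
    apply mulVec_pinv_mulVec
    refine ⟨g, (P.Hss_mulVec_eq_iff _ _ _).2 ⟨hgu, fun i hi => ?_⟩⟩
    rw [(hx.comb g hi).2, hgu i hi, hgx i (Nat.le_of_lt_succ hi), hys]

/-- The constraint on `β` is feasible, and `solveβ` satisfies it. -/
theorem Hβ_mulVec_solveβ (hx : sys.IsStateOf P.ud P.yd x) (hc : sys.Controllable)
    (hμ : sys.ctrbIndex ≤ μ) (hpe : PersistentlyExciting P.ud (3 * n + μ + 1))
    {zs : IOSpace m p} (hzs : zs ∈ sys.steadyStates)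
    (a : Fin (N + 1 - (2 * n + μ + 1)) → ℝ) :
    P.Hβ *ᵥ (P.solveβ *ᵥ P.gVec zs a) = P.gVec zs a := by
  rw [Matrix.mulVec_mulVec, solveβ, mul_weighted_pinv, ← Matrix.mulVec_mulVec]
  apply mulVec_pinv_mulVec
  obtain ⟨xs, hs, hys⟩ := hzs
  obtain ⟨v, hv⟩ := sys.exists_sim_eq (hc.rank_ctrbMatrix hμ) 0 (xs - comb a x (n + μ))
  -- No change in the past, `μ` steps of steering to the missing state difference, then whatever
  -- makes the total input constant. The length `2n + μ + 1` plus `n` is exactly the assumed order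
  -- of excitation.
  set u : ℕ → Fin m → ℝ := fun k => if k < n then 0 else if k < n + μ then v (k - n) else
    inPart zs - comb a (extend P.ud) k with hu
  obtain ⟨b, hb0, hbu⟩ := LTI.exists_comb_eq hx hc (L := 2 * n + μ + 1) (by omega) hpe 0 u
  have hbx : ∀ k ≤ 2 * n + μ + 1, comb b x k = sys.sim 0 u k := fun k hk =>
    sys.eq_sim hb0 (fun i hi => by rw [← hbu i hi]; exact (hx.comb b hi).1) hk
  have hbx0 : ∀ k ≤ n, comb b x k = 0 := by
    intro k hk
    rw [hbx k (by omega)]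
    exact sys.sim_zero fun j hj => if_pos (by omega)
  have hbu0 : ∀ k < n, comb b (extend P.ud) k = 0 := by
    intro k hk
    rw [hbu k (by omega)]
    exact if_pos hk
  have habu : ∀ i < n + 1, comb (a + b) (extend P.ud) (n + μ + i) = inPart zs := by
    intro i hi
    rw [comb_add, hbu _ (by omega)]
    simp only [hu]
    rw [if_neg (by omega), if_neg (by omega), add_sub_cancel]
  have habx0 : comb (a + b) x (n + μ) = xs := by
    have : comb b x (n + μ) = xs - comb a x (n + μ) := by
      rw [hbx _ (by omega), LTI.sim_add, ← hbx n (by omega), hbx0 n le_rfl, ← hv]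
      refine sys.sim_congr fun j hj => ?_
      simp only [hu]
      rw [if_neg (by omega), if_pos (by omega), Nat.add_sub_cancel_left]
    rw [comb_add, this, add_sub_cancel]
  have habx : ∀ i ≤ n, comb (a + b) x (n + μ + i) = xs := fun i hi =>
    sys.eq_steadyState (x := fun i => comb (a + b) x (n + μ + i))
      (u := fun i => comb (a + b) (extend P.ud) (n + μ + i)) hs habx0
      (fun k hk => (hx.comb (a + b) (i := n + μ + k) (by omega)).1) (fun k hk => habu k (by omega)) hi
  refine ⟨b, (P.Hβ_mulVec_eq_gVec_iff zs a b).2 ⟨hbu0, habu, fun i hi => ?_, fun i hi => ?_⟩⟩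
  · rw [(hx.comb b (by omega)).2, hbu0 i hi, hbx0 i hi.le, Matrix.mulVec_zero, Matrix.mulVec_zero,
      add_zero]
  · rw [(hx.comb (a + b) (by omega)).2, habu i (by omega), habx i hi.le, hys]

/-- The corrected trajectory agrees with the old one up to the present time, and it is at the new
steady state after `μ` further steps. -/
theorem comb_of_Hβ_mulVec_eq_gVec (hx : sys.IsStateOf P.ud P.yd x) (ho : sys.Observable)
    {zs : IOSpace m p} {xs : Fin n → ℝ} (hs : xs = sys.A *ᵥ xs + sys.B *ᵥ inPart zs)
    (hys : outPart zs = sys.C *ᵥ xs + sys.D *ᵥ inPart zs)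
    {a b : Fin (N + 1 - (2 * n + μ + 1)) → ℝ} (h : P.Hβ *ᵥ b = P.gVec zs a) :
    comb (a + b) x n = comb a x n ∧ comb (a + b) x (n + μ) = xs := by
  obtain ⟨h1, h2, h3, h4⟩ := (P.Hβ_mulVec_eq_gVec_iff zs a b).1 h
  constructor
  · have := ho.eq_of_outputs_eq (x := comb b x) (x' := fun _ => 0) (u' := fun _ => 0)
      (y' := fun _ => 0) (fun k hk => hx.comb b (by omega)) (fun k hk => by simp) h1 h3 n le_rfl
    rw [comb_add, this, add_zero]
  · exact ho.eq_of_outputs_eq (x := fun i => comb (a + b) x (n + μ + i)) (x' := fun _ => xs)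
      (u := fun i => comb (a + b) (extend P.ud) (n + μ + i)) (u' := fun _ => inPart zs)
      (y := fun i => comb (a + b) (extend P.yd) (n + μ + i)) (y' := fun _ => outPart zs)
      (fun k hk => hx.comb (a + b) (i := n + μ + k) (by omega)) (fun k hk => ⟨hs, hys⟩)
      (fun k hk => h2 k (by omega)) h4 0 n.zero_le

end AlgParams

end DDOCO

namespace DDOCO

/-! ### The closed loop -/

namespace IsClosedLoop

variable {n m p μ N r : ℕ} {sys : LTI n m p} {P : AlgParams n m p μ N r} {x : ℕ → Fin n → ℝ}
  {init : AlgInit n m p μ} {cost : ℤ → IOSpace m p → ℝ}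
  {σ : Signals n m p μ (N + 1 - (2 * n + μ + 1))} {xi : ℕ → Fin n → ℝ}

theorem zs_eq_kerProj (hσ : IsClosedLoop sys P init cost σ) (t : ℕ) :
    σ.zs t = kerProj P.S (σ.zμ t - P.γ • gradient (cost ((t : ℤ) - 1)) (σ.zμ t)) :=
  hσ.zs_eq t (Int.natCast_nonneg t)

theorem S_mulVec_zs (hσ : IsClosedLoop sys P init cost σ) (t : ℕ) :
    P.S *ᵥ WithLp.ofLp (σ.zs t) = 0 := by
  rw [hσ.zs_eq_kerProj]; exact mulVec_kerProj P.S _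

theorem Hβ_mulVec_β (hσ : IsClosedLoop sys P init cost σ) (hx : sys.IsStateOf P.ud P.yd x)
    (hc : sys.Controllable) (ho : sys.Observable) (hμ : sys.ctrbIndex ≤ μ)
    (hpe : PersistentlyExciting P.ud (3 * n + μ + 1)) (t : ℕ) :
    P.Hβ *ᵥ σ.β t = P.gVec (σ.zs t) (σ.α t) := by
  rw [hσ.β_eq t (Int.natCast_nonneg t)]
  exact AlgParams.Hβ_mulVec_solveβ hx hc hμ hpe
    ((AlgParams.S_mulVec_eq_zero_iff hx hc ho hpe _).1 (hσ.S_mulVec_zs t)) _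

theorem u_eq_comb (hσ : IsClosedLoop sys P init cost σ) (t : ℕ) :
    σ.u t = comb (σ.α t + σ.β t) (extend P.ud) n := by
  rw [hσ.u_eq t (Int.natCast_nonneg t), P.blockRow_U_mulVec]

theorem uhat_eq_comb (hσ : IsClosedLoop sys P init cost σ) (t : ℕ) (j : Fin (μ + 1)) :
    σ.uhat t j = comb (σ.α t + σ.β t) (extend P.ud) (n + j) := by
  funext c
  have := congrFun (hσ.uhat_eq t (Int.natCast_nonneg t)) (j, c)
  rwa [P.blockRows_U_mulVec] at this

/-- The inputs and the corrected outputs are a trajectory of the system, from whose present state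
`α` starts to predict. -/
theorem estimate (hσ : IsClosedLoop sys P init cost σ) (hx : sys.IsStateOf P.ud P.yd x)
    (hc : sys.Controllable) (ho : sys.Observable) (hμ : sys.ctrbIndex ≤ μ)
    (hpe : PersistentlyExciting P.ud (3 * n + μ + 1))
    (hxi : ∀ k : Fin n, xi (k + 1) = sys.A *ᵥ xi k + sys.B *ᵥ init.u k ∧
      init.yc k = sys.C *ᵥ xi k + sys.D *ᵥ init.u k) :
    (∀ k : ℕ, σ.ym (k - n) - σ.ehat (k - n) =
      sys.C *ᵥ sys.sim (xi 0) (fun k => σ.u (k - n)) k + sys.D *ᵥ σ.u (k - n)) ∧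
    ∀ t : ℕ, comb (σ.α t) x n = sys.sim (xi 0) (fun k => σ.u (k - n)) (t + n) := by
  set xh := sys.sim (xi 0) (fun k => σ.u (k - n)) with hxh
  have hcast : ∀ (t : ℕ) (i : ℕ), (t : ℤ) - n + i = ((t + i : ℕ) : ℤ) - n := by
    intro t i; push_cast; ring
  -- The two claims feed each other: exact corrected outputs before time `t` place `α t` at the
  -- simulated state, and this makes the corrected output at time `t` exact. The index `k` stands
  -- for time `k - n`.
  have hα : ∀ t : ℕ, (∀ k < t + n, σ.ym (k - n) - σ.ehat (k - n) =
      sys.C *ᵥ xh k + sys.D *ᵥ σ.u (k - n)) → comb (σ.α t) x n = xh (t + n) := by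
    intro t ht
    obtain ⟨h1, -, -, h4⟩ := P.Hα_mulVec_eq (hσ.α_eq t (Int.natCast_nonneg t))
    refine ho.eq_of_outputs_eq (x := comb (σ.α t) x) (x' := fun k => xh (t + k))
      (u := comb (σ.α t) (extend P.ud)) (u' := fun k => σ.u ((t + k : ℕ) - n))
      (y := comb (σ.α t) (extend P.yd))
      (y' := fun k => σ.ym ((t + k : ℕ) - n) - σ.ehat ((t + k : ℕ) - n))
      (fun k hk => hx.comb _ (by omega)) (fun k hk => ⟨rfl, ht _ (by omega)⟩) (fun k hk => ?_)
      (fun k hk => ?_) n le_rfl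
    · rw [← hcast]; exact h1 ⟨k, hk⟩
    · rw [← hcast]; exact h4 ⟨k, hk⟩
  have hy : ∀ k : ℕ, σ.ym (k - n) - σ.ehat (k - n) =
      sys.C *ᵥ xh k + sys.D *ᵥ σ.u (k - n) := by
    intro k
    induction k using Nat.strong_induction_on with
    | _ k ih =>
      rcases lt_or_ge k n with hk | hk
      · have hz : ∀ i : ℕ, (0 : ℤ) - n + i = i - n := fun i => by ring
        have hu : ∀ i (hi : i < n), σ.u ((i : ℤ) - n) = init.u ⟨i, hi⟩ := by
          intro i hi
          rw [← hσ.init_u, window, hz]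
        have hyc : σ.ym ((k : ℤ) - n) - σ.ehat ((k : ℤ) - n) = init.yc ⟨k, hk⟩ := by
          rw [← hσ.init_y, Pi.sub_apply, window, window, hz]
        have hxk : xi k = xh k := by
          refine sys.eq_sim rfl (fun i hi => ?_) le_rfl
          rw [hu i (hi.trans hk)]
          exact (hxi ⟨i, hi.trans hk⟩).1
        rw [hyc, (hxi ⟨k, hk⟩).2, ← hxk, hu k hk]
      · obtain ⟨t, rfl⟩ := Nat.exists_eq_add_of_le' hk
        have ht : ((t + n : ℕ) : ℤ) - n = t := by push_cast; ring
        have h1 := hα t ih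
        obtain ⟨xs, hs, hys⟩ :=
          (AlgParams.S_mulVec_eq_zero_iff hx hc ho hpe _).1 (hσ.S_mulVec_zs t)
        have h2 := (AlgParams.comb_of_Hβ_mulVec_eq_gVec hx ho hs hys
          (hσ.Hβ_mulVec_β hx hc ho hμ hpe t)).1
        -- Here the measurement `ym t` cancels, and with it the noise.
        rw [ht, hσ.ehat_eq t (Int.natCast_nonneg t), sub_sub_cancel, P.blockRow_Y_mulVec,
          (hx.comb _ (by omega)).2, h2, h1, ← hσ.u_eq_comb]
  exact ⟨hy, fun t => hα t fun k _ => hy k⟩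

/-- After the first step, `α` predicts that the previous steady state is reached. -/
theorem comb_α_succ (hσ : IsClosedLoop sys P init cost σ) (hx : sys.IsStateOf P.ud P.yd x)
    (hc : sys.Controllable) (ho : sys.Observable) (hμ : sys.ctrbIndex ≤ μ)
    (hpe : PersistentlyExciting P.ud (3 * n + μ + 1)) (hinit : sys.IsTrajectory init.u init.yc)
    (t : ℕ) :
    (∀ j : Fin μ, comb (σ.α (t + 1 : ℕ)) (extend P.ud) (n + j) = σ.uhat t j.succ) ∧
    (∀ i < n + 1, comb (σ.α (t + 1 : ℕ)) (extend P.ud) (n + μ + i) = inPart (σ.zs t)) ∧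
    ∀ i < n + 1, comb (σ.α (t + 1 : ℕ)) (extend P.yd) (n + μ + i) = outPart (σ.zs t) := by
  obtain ⟨xi, hxi⟩ := hinit
  have he := (hσ.estimate hx hc ho hμ hpe hxi).2
  have hcast : ((t + 1 : ℕ) : ℤ) - 1 = t := by push_cast; ring
  have hcast' : ((t + n : ℕ) : ℤ) - n = t := by push_cast; ring
  obtain ⟨-, h2, h3, -⟩ := P.Hα_mulVec_eq (hσ.α_eq (t + 1 : ℕ) (Int.natCast_nonneg _))
  rw [hcast] at h2 h3
  refine ⟨h2, h3, ?_⟩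
  obtain ⟨xs, hs, hys⟩ := (AlgParams.S_mulVec_eq_zero_iff hx hc ho hpe _).1 (hσ.S_mulVec_zs t)
  have hβ := hσ.Hβ_mulVec_β hx hc ho hμ hpe t
  obtain ⟨hb1, hb2⟩ := AlgParams.comb_of_Hβ_mulVec_eq_gVec hx ho hs hys hβ
  have hbu := ((P.Hβ_mulVec_eq_gVec_iff _ _ _).1 hβ).2.1 0 n.succ_pos
  -- The new `α` follows the old `α + β` shifted by one: same state after the applied input, then
  -- the same planned inputs.
  have hstep : ∀ i ≤ μ, comb (σ.α (t + 1 : ℕ)) x (n + i) =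
      comb (σ.α t + σ.β t) x (n + i + 1) := by
    intro i hi
    induction i with
    | zero =>
      rw [add_zero, he, (hx.comb _ (by omega)).1, hb1, he, ← hσ.u_eq_comb, Nat.add_right_comm t 1 n,
        LTI.sim, hcast']
    | succ i ih =>
      have h5 := h2 ⟨i, hi⟩
      rw [hσ.uhat_eq_comb, Fin.val_succ] at h5
      rw [← add_assoc, (hx.comb _ (by omega)).1, (hx.comb _ (by omega)).1,
        ih (Nat.le_of_succ_le hi)]
      simp only [h5, ← add_assoc]
  -- The old plan is at `xs` at index `n + μ` and its input there is the steady one, so it is still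
  -- at `xs` one step later.
  have hμx : comb (σ.α (t + 1 : ℕ)) x (n + μ) = xs := by
    rw [hstep μ le_rfl, (hx.comb _ (by omega)).1, hb2]
    rw [add_zero] at hbu
    rw [hbu, ← hs]
  intro i hi
  have h6 : comb (σ.α (t + 1 : ℕ)) x (n + μ + i) = xs :=
    sys.eq_steadyState (x := fun i => comb (σ.α (t + 1 : ℕ)) x (n + μ + i))
      (u := fun i => comb (σ.α (t + 1 : ℕ)) (extend P.ud) (n + μ + i)) hs hμx
      (fun k hk => (hx.comb _ (i := n + μ + k) (by omega)).1) (fun k hk => h3 k (by omega))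
      (Nat.le_of_lt_succ hi)
  rw [(hx.comb _ (by omega)).2, h6, h3 i hi, hys]

theorem zμ_succ (hσ : IsClosedLoop sys P init cost σ) (hx : sys.IsStateOf P.ud P.yd x)
    (hc : sys.Controllable) (ho : sys.Observable) (hμ : sys.ctrbIndex ≤ μ)
    (hpe : PersistentlyExciting P.ud (3 * n + μ + 1)) (hinit : sys.IsTrajectory init.u init.yc)
    (t : ℕ) : σ.zμ (t + 1 : ℕ) = σ.zs t := by
  have hcast : ((t + 1 : ℕ) : ℤ) - 1 = t := by push_cast; ring
  rw [hσ.zμ_eq _ (Int.natCast_nonneg _), hcast, P.blockRow_Y_mulVec,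
    ← add_zero (n + μ), (hσ.comb_α_succ hx hc ho hμ hpe hinit t).2.2 0 n.succ_pos,
    ioPair_inPart_outPart]

/-- The tail predicted by `α` sits at the previous steady state, so the entries of `g` are zeros and
components of `zs (t + 1) - zs t`. -/
theorem norm_gVec_succ_le (hσ : IsClosedLoop sys P init cost σ) (hx : sys.IsStateOf P.ud P.yd x)
    (hc : sys.Controllable) (ho : sys.Observable) (hμ : sys.ctrbIndex ≤ μ)
    (hpe : PersistentlyExciting P.ud (3 * n + μ + 1)) (hinit : sys.IsTrajectory init.u init.yc)
    (t : ℕ) : ‖P.gVec (σ.zs (t + 1 : ℕ)) (σ.α (t + 1 : ℕ))‖ ≤ ‖σ.zs (t + 1 : ℕ) - σ.zs t‖ := by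
  obtain ⟨-, h1, h2⟩ := hσ.comb_α_succ hx hc ho hμ hpe hinit t
  rw [P.gVec_eq h1 (fun i hi => h2 i (hi.trans n.lt_succ_self))]
  refine (pi_norm_le_iff_of_nonneg (norm_nonneg _)).2 fun q => ?_
  rcases q with q | ⟨i, c⟩ | q | ⟨i, c⟩
  · simp
  · exact PiLp.norm_apply_le (σ.zs (t + 1 : ℕ) - σ.zs t) (Sum.inl c)
  · simp
  · exact PiLp.norm_apply_le (σ.zs (t + 1 : ℕ) - σ.zs t) (Sum.inr c)

/-- The initialization determines the first steady state and the first input prediction. -/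
theorem zs_zero_unique (hσ : IsClosedLoop sys P init cost σ) (hx : sys.IsStateOf P.ud P.yd x)
    (hc : sys.Controllable) (ho : sys.Observable) (hμ : sys.ctrbIndex ≤ μ)
    (hpe : PersistentlyExciting P.ud (3 * n + μ + 1)) (hinit : sys.IsTrajectory init.u init.yc)
    {cost' : ℤ → IOSpace m p → ℝ} {σ' : Signals n m p μ (N + 1 - (2 * n + μ + 1))}
    (hσ' : IsClosedLoop sys P init cost' σ') :
    σ.zs (0 : ℕ) = σ'.zs (0 : ℕ) ∧ σ.uhat (0 : ℕ) = σ'.uhat (0 : ℕ) := by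
  obtain ⟨xi, hxi⟩ := hinit
  have he := (hσ.estimate hx hc ho hμ hpe hxi).2 0
  have he' := (hσ'.estimate hx hc ho hμ hpe hxi).2 0
  have hz : ∀ i : ℕ, (0 : ℤ) - n + i = i - n := fun i => by ring
  have hcast : ((0 : ℕ) : ℤ) - 1 = -1 := rfl
  obtain ⟨-, h2, h3, -⟩ := P.Hα_mulVec_eq (hσ.α_eq (0 : ℕ) le_rfl)
  obtain ⟨-, h2', h3', -⟩ := P.Hα_mulVec_eq (hσ'.α_eq (0 : ℕ) le_rfl)
  rw [hcast] at h2 h3 h2' h3'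
  rw [hσ.init_uhat] at h2
  rw [hσ'.init_uhat] at h2'
  rw [hσ.init_zs] at h3
  rw [hσ'.init_zs] at h3'
  -- The coefficients `α 0` need not agree, but the trajectories they generate do: same inputs, and
  -- the same present state by `estimate`.
  have hu : ∀ i < n + μ + 1, comb (σ.α (0 : ℕ)) (extend P.ud) (n + i) =
      comb (σ'.α (0 : ℕ)) (extend P.ud) (n + i) := by
    intro i hi
    rcases lt_or_ge i μ with h | h
    · exact (h2 ⟨i, h⟩).trans (h2' ⟨i, h⟩).symm
    · obtain ⟨j, rfl⟩ := Nat.exists_eq_add_of_le h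
      rw [← add_assoc, h3 j (by omega), h3' j (by omega)]
  have h0 : comb (σ.α (0 : ℕ)) x n = comb (σ'.α (0 : ℕ)) x n := by
    rw [he, he']
    refine sys.sim_congr fun j hj => ?_
    have h5 := congrFun (hσ.init_u.trans hσ'.init_u.symm) ⟨j, by omega⟩
    simp only [window, hz] at h5
    exact h5
  have hxeq : ∀ i ≤ n + μ + 1, comb (σ.α (0 : ℕ)) x (n + i) =
      comb (σ'.α (0 : ℕ)) x (n + i) := by
    intro i hi
    induction i with
    | zero => exact h0
    | succ i ih =>
      rw [← add_assoc, (hx.comb _ (by omega)).1, (hx.comb _ (by omega)).1, ih (by omega),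
        hu i (by omega)]
  have hy : ∀ i < n + μ + 1, comb (σ.α (0 : ℕ)) (extend P.yd) (n + i) =
      comb (σ'.α (0 : ℕ)) (extend P.yd) (n + i) := by
    intro i hi
    rw [(hx.comb _ (by omega)).2, (hx.comb _ (by omega)).2, hxeq i hi.le, hu i hi]
  have hzμ : σ.zμ (0 : ℕ) = σ'.zμ (0 : ℕ) := by
    rw [hσ.zμ_eq (0 : ℕ) le_rfl, hσ'.zμ_eq (0 : ℕ) le_rfl, hcast, hσ.init_zs, hσ'.init_zs,
      P.blockRow_Y_mulVec, P.blockRow_Y_mulVec, hy μ (by omega)]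
  have hzs : σ.zs (0 : ℕ) = σ'.zs (0 : ℕ) := by
    rw [hσ.zs_eq_kerProj, hσ'.zs_eq_kerProj, hcast, hσ.init_cost, hσ'.init_cost, hzμ]
  have hβ : σ.β (0 : ℕ) = σ'.β (0 : ℕ) := by
    rw [hσ.β_eq (0 : ℕ) le_rfl, hσ'.β_eq (0 : ℕ) le_rfl, hzs,
      P.gVec_eq (zs := σ'.zs (0 : ℕ)) (a := σ.α (0 : ℕ))
        (b := fun i => comb (σ'.α (0 : ℕ)) (extend P.ud) (n + μ + i))
        (d := fun i => comb (σ'.α (0 : ℕ)) (extend P.yd) (n + μ + i))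
        (fun i hi => by rw [add_assoc n μ i]; exact hu _ (by omega))
        (fun i hi => by rw [add_assoc n μ i]; exact hy _ (by omega)),
      P.gVec_eq (zs := σ'.zs (0 : ℕ)) (a := σ'.α (0 : ℕ)) (fun i _ => rfl) (fun i _ => rfl)]
  refine ⟨hzs, funext fun j => ?_⟩
  rw [hσ.uhat_eq_comb, hσ'.uhat_eq_comb, comb_add, comb_add, hβ, hu j (by have := j.2; omega)]

end IsClosedLoop

end DDOCO

namespace DDOCO

/-! ### Summation of recursive estimates -/

/-- Sum the recursion and absorb `κ` times the sum on the left. -/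
theorem sum_le_of_contraction {κ A : ℝ} (hκ0 : 0 ≤ κ) (hκ : κ < 1) {a d : ℕ → ℝ}
    (ha : ∀ t, 0 ≤ a t) (h0 : a 0 ≤ A + d 0) (h : ∀ t, a (t + 1) ≤ κ * a t + d (t + 1)) (T : ℕ) :
    ∑ t ∈ Finset.range (T + 1), a t ≤
      (1 - κ)⁻¹ * (A + ∑ t ∈ Finset.range (T + 1), d t) := by
  have h1 : ∑ t ∈ Finset.range (T + 1), a t ≤
      A + ∑ t ∈ Finset.range (T + 1), d t + κ * ∑ t ∈ Finset.range (T + 1), a t := by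
    conv_lhs => rw [Finset.sum_range_succ']
    rw [Finset.sum_range_succ' d, Finset.sum_range_succ a]
    have h2 := Finset.sum_le_sum (s := Finset.range T) fun t _ => h t
    rw [Finset.sum_add_distrib, ← Finset.mul_sum] at h2
    nlinarith [mul_nonneg hκ0 (ha T)]
  rw [← div_eq_inv_mul, le_div_iff₀ (sub_pos.2 hκ)]
  linarith

/-- Errors move from level `i` to level `i + 1` in one time step and start from zero at level 0, so
each level adds at most one `B` and one copy of `∑ d`. -/
theorem sum_le_of_cascade {B : ℝ} {μ : ℕ} {w : ℕ → ℕ → ℝ} {d : ℕ → ℝ}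
    (h0 : ∀ t, w 0 t ≤ 0) (hinit : ∀ i ≤ μ, w i 0 ≤ B)
    (h : ∀ i < μ, ∀ t, w (i + 1) (t + 1) ≤ w i t + d t) (hw : ∀ i t, 0 ≤ w i t) (T : ℕ) :
    ∀ i ≤ μ, ∑ t ∈ Finset.range (T + 1), w i t ≤ i * (B + ∑ t ∈ Finset.range T, d t) := by
  intro i hi
  induction i with
  | zero =>
    rw [Nat.cast_zero, zero_mul]
    exact Finset.sum_nonpos fun t _ => h0 t
  | succ i ih =>
    rw [Finset.sum_range_succ']
    have h1 := Finset.sum_le_sum (s := Finset.range T) fun t _ => h i hi t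
    rw [Finset.sum_add_distrib] at h1
    have h2 := ih (Nat.le_of_succ_le hi)
    rw [Finset.sum_range_succ] at h2
    have h3 := hinit (i + 1) hi
    push_cast
    linarith [hw i T]

/-! ### Regret -/

section

variable {n m p μ N r : ℕ} {sys : LTI n m p} {P : AlgParams n m p μ N r}

/-- By `zs_zero_unique` any one closed loop supplies the constant for all, whatever the costs, noise
and true state; without a closed loop there is nothing to bound. -/
theorem exists_init_bound (h_ctrb : sys.Controllable) (h_obsv : sys.Observable)
    (h_data : sys.IsTrajectory P.ud P.yd) (h_horizon : sys.ctrbIndex ≤ μ)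
    (h_pe : PersistentlyExciting P.ud (3 * n + μ + 1)) {init : AlgInit n m p μ}
    (hinit : sys.IsTrajectory init.u init.yc) :
    ∃ A : ℝ, 0 ≤ A ∧ ∀ (cost : ℤ → IOSpace m p → ℝ)
      (σ : Signals n m p μ (N + 1 - (2 * n + μ + 1))), IsClosedLoop sys P init cost σ →
      ‖σ.zs (0 : ℕ)‖ ≤ A ∧ ∀ j, ‖σ.uhat (0 : ℕ) j‖ ≤ A := by
  obtain ⟨x, hx⟩ := h_data.exists_isStateOf
  by_cases hex : ∃ (cost : ℤ → IOSpace m p → ℝ)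
      (σ : Signals n m p μ (N + 1 - (2 * n + μ + 1))), IsClosedLoop sys P init cost σ
  · obtain ⟨cost₀, σ₀, h₀⟩ := hex
    refine ⟨max ‖σ₀.zs (0 : ℕ)‖ ‖σ₀.uhat (0 : ℕ)‖, le_max_of_le_left (norm_nonneg _),
      fun cost σ hσ => ?_⟩
    obtain ⟨h1, h2⟩ := hσ.zs_zero_unique hx h_ctrb h_obsv h_horizon h_pe hinit h₀
    rw [h1, h2]
    exact ⟨le_max_left _ _, fun j => (norm_le_pi_norm _ j).trans (le_max_right _ _)⟩
  · exact ⟨0, le_rfl, fun cost σ hσ => (hex ⟨cost, σ, hσ⟩).elim⟩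

/-- The predicted inputs approach the steady state input. -/
theorem exists_uhat_bound (h_ctrb : sys.Controllable) (h_obsv : sys.Observable)
    (h_data : sys.IsTrajectory P.ud P.yd) (h_horizon : sys.ctrbIndex ≤ μ)
    (h_pe : PersistentlyExciting P.ud (3 * n + μ + 1)) :
    ∃ c : ℝ, 0 ≤ c ∧ ∀ init : AlgInit n m p μ, sys.IsTrajectory init.u init.yc →
      ∃ A : ℝ, 0 ≤ A ∧ ∀ (cost : ℤ → IOSpace m p → ℝ)
        (σ : Signals n m p μ (N + 1 - (2 * n + μ + 1))), IsClosedLoop sys P init cost σ →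
        ∀ T : ℕ, ∑ t ∈ Finset.range (T + 1), ‖σ.u t - inPart (σ.zs t)‖ ≤
          A + c * ∑ t ∈ Finset.range T, ‖σ.zs (t + 1 : ℕ) - σ.zs t‖ := by
  obtain ⟨x, hx⟩ := h_data.exists_isStateOf
  obtain ⟨cs, hcs, hsolve⟩ := exists_norm_mulVec_le P.solveβ
  obtain ⟨cU, hcU, hU⟩ := exists_norm_mulVec_le (blockRows P.U n (μ + 1) (by omega))
  refine ⟨μ * (cU * cs + 1), by positivity, fun init hinit => ?_⟩
  obtain ⟨A, hA, hbound⟩ := exists_init_bound h_ctrb h_obsv h_data h_horizon h_pe hinit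
  refine ⟨μ * (A + A), by positivity, fun cost σ hσ T => ?_⟩
  set δ : ℕ → ℝ := fun t => ‖σ.zs (t + 1 : ℕ) - σ.zs t‖ with hδ
  -- Error of the planned input `i` places before the end of the plan: level 0 is exact by the
  -- terminal constraint, level `μ` is the input applied now.
  set w : ℕ → ℕ → ℝ := fun i t =>
    ‖σ.uhat t ⟨μ - i, by omega⟩ - inPart (σ.zs t)‖ with hw
  have hβ : ∀ t : ℕ, ∀ j : Fin (μ + 1),
      ‖comb (σ.β (t + 1 : ℕ)) (extend P.ud) (n + j)‖ ≤ cU * cs * δ t := by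
    intro t j
    have h1 : ‖σ.β (t + 1 : ℕ)‖ ≤ cs * δ t := by
      rw [hσ.β_eq _ (Int.natCast_nonneg _)]
      exact (hsolve _).trans (mul_le_mul_of_nonneg_left
        (hσ.norm_gVec_succ_le hx h_ctrb h_obsv h_horizon h_pe hinit t) hcs)
    have h2 : ‖comb (σ.β (t + 1 : ℕ)) (extend P.ud) (n + j)‖ ≤ cU * ‖σ.β (t + 1 : ℕ)‖ := by
      refine (pi_norm_le_iff_of_nonneg (by positivity)).2 fun c => ?_
      have h3 := (norm_le_pi_norm _ (j, c)).trans (hU (σ.β (t + 1 : ℕ)))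
      rwa [P.blockRows_U_mulVec] at h3
    rw [mul_assoc]
    exact h2.trans (mul_le_mul_of_nonneg_left h1 hcU)
  have hδle : ∀ t : ℕ, ‖inPart (σ.zs t) - inPart (σ.zs (t + 1 : ℕ))‖ ≤ δ t := by
    intro t
    rw [norm_sub_rev]
    exact norm_inPart_le (σ.zs (t + 1 : ℕ) - σ.zs t)
  have hw0 : ∀ t, w 0 t ≤ 0 := by
    intro t
    have h1 := ((P.Hβ_mulVec_eq_gVec_iff _ _ _).1
      (hσ.Hβ_mulVec_β hx h_ctrb h_obsv h_horizon h_pe t)).2.1 0 n.succ_pos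
    simp only [hw]
    rw [hσ.uhat_eq_comb]
    change ‖comb (σ.α t + σ.β t) (extend P.ud) (n + μ + 0) - _‖ ≤ 0
    rw [h1, sub_self, norm_zero]
  -- The shifted plan keeps its error, `β` adds `cU * cs * δ`, and the move of the reference input
  -- adds `δ`.
  have hstep : ∀ i < μ, ∀ t, w (i + 1) (t + 1) ≤ w i t + (cU * cs + 1) * δ t := by
    intro i hi t
    have hα := (hσ.comb_α_succ hx h_ctrb h_obsv h_horizon h_pe hinit t).1 ⟨μ - (i + 1), by omega⟩
    have hidx : (⟨μ - (i + 1), by omega⟩ : Fin μ).succ = ⟨μ - i, by omega⟩ :=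
      Fin.ext (by simp only [Fin.val_succ]; omega)
    rw [hidx] at hα
    have hb := hβ t ⟨μ - (i + 1), by omega⟩
    simp only [hw]
    rw [hσ.uhat_eq_comb, comb_add, hα]
    have hsplit : ∀ a b c d : Fin m → ℝ, a + b - d = (a - c) + b + (c - d) := by
      intro a b c d; abel
    rw [hsplit _ _ (inPart (σ.zs t))]
    refine (norm_add₃_le).trans ?_
    linarith [hδle t]
  have hinit' : ∀ i ≤ μ, w i 0 ≤ A + A := by
    intro i _
    obtain ⟨h1, h2⟩ := hbound cost σ hσ
    exact (norm_sub_le _ _).trans (add_le_add (h2 _) ((norm_inPart_le _).trans h1))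
  have hsum := sum_le_of_cascade hw0 hinit' hstep (fun _ _ => norm_nonneg _) T μ le_rfl
  rw [← Finset.mul_sum] at hsum
  have hu : ∀ t : ℕ, ‖σ.u t - inPart (σ.zs t)‖ = w μ t := by
    intro t
    simp only [hw]
    rw [hσ.uhat_eq_comb, hσ.u_eq_comb]
    simp only [Nat.sub_self, add_zero]
  rw [Finset.sum_congr rfl fun t _ => hu t]
  linarith

/-- Plant and simulation share their inputs, so their difference is a free response. Its first `n`
outputs are `ê - e`, hence observability bounds its start by `E₀`, and stability sums it. -/
theorem exists_noise_bound (h_schur : sys.SchurStable) (h_ctrb : sys.Controllable)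
    (h_obsv : sys.Observable) (h_data : sys.IsTrajectory P.ud P.yd) (h_horizon : sys.ctrbIndex ≤ μ)
    (h_pe : PersistentlyExciting P.ud (3 * n + μ + 1)) :
    ∃ c : ℝ, 0 ≤ c ∧ ∀ (init : AlgInit n m p μ) (xi : ℕ → Fin n → ℝ),
      (∀ k : Fin n, xi (k + 1) = sys.A *ᵥ xi k + sys.B *ᵥ init.u k ∧
        init.yc k = sys.C *ᵥ xi k + sys.D *ᵥ init.u k) →
      ∀ (cost : ℤ → IOSpace m p → ℝ) (σ : Signals n m p μ (N + 1 - (2 * n + μ + 1))),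
        IsClosedLoop sys P init cost σ → ∀ T : ℕ, ∑ t ∈ Finset.range (T + 1),
          ‖σ.x t - sys.sim (xi 0) (fun k => σ.u (k - n)) (t + n)‖ ≤ c * σ.E₀ := by
  obtain ⟨x, hx⟩ := h_data.exists_isStateOf
  obtain ⟨K, hK, hgain, -⟩ := h_schur.exists_gain
  obtain ⟨co, hco, hobs⟩ := h_obsv.exists_bound
  refine ⟨K * co, by positivity, fun init xi hxi cost σ hσ T => ?_⟩
  set xh := sys.sim (xi 0) (fun k => σ.u (k - n)) with hxh
  set e : ℕ → Fin n → ℝ := fun k => σ.x (k - n) - xh k with he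
  have hcast : ∀ k : ℕ, ((k + 1 : ℕ) : ℤ) - n = (k : ℤ) - n + 1 := fun k => by push_cast; ring
  have hle : ∀ k : ℕ, -(n : ℤ) ≤ (k : ℤ) - n := fun k => by omega
  have hstep : ∀ k, e (k + 1) = sys.A *ᵥ e k + 0 := by
    intro k
    simp only [he]
    rw [hcast, hσ.state_eq _ (hle k), hxh, LTI.sim, Matrix.mulVec_sub]
    abel
  have hpow : ∀ k, e k = sys.A ^ k *ᵥ e 0 := by
    intro k
    induction k with
    | zero => simp
    | succ k ih => rw [hstep, ih, add_zero, Matrix.mulVec_mulVec, ← pow_succ']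
  have h0 : ‖e 0‖ ≤ co * σ.E₀ := by
    have h1 := hobs (e 0) (fun i => window n σ.ehat 0 i - window n σ.e 0 i) (fun k => by
      have h2 := (hσ.estimate hx h_ctrb h_obsv h_horizon h_pe hxi).1 k
      have hz : (0 : ℤ) - n + (k : ℕ) = ((k : ℕ) : ℤ) - n := by ring
      rw [← hpow, window, window, hz]
      simp only [he]
      rw [Matrix.mulVec_sub]
      rw [hσ.measured_eq _ (hle k), hσ.output_eq _ (hle k), ← hxh] at h2
      rw [← sub_eq_zero] at h2 ⊢
      rw [← h2]
      abel)
    refine h1.trans (mul_le_mul_of_nonneg_left ?_ hco)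
    refine (pi_norm_le_iff_of_nonneg (norm_nonneg _)).2 fun q => ?_
    have h3 := PiLp.norm_apply_le (WithLp.toLp 2 (stack (window n σ.e 0) -
      stack (window n σ.ehat 0)) : EuclideanSpace ℝ (Fin n × Fin p)) q
    have h4 : (stack fun i => window n σ.ehat 0 i - window n σ.e 0 i) q =
        -((stack (window n σ.e 0) - stack (window n σ.ehat 0)) q) := (neg_sub _ _).symm
    rw [h4, norm_neg]
    exact h3
  have h1 := hgain e (fun _ => 0) hstep (n + T)
  simp only [norm_zero, Finset.sum_const_zero, add_zero] at h1
  rw [add_assoc, Finset.sum_range_add] at h1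
  have h2 : ∀ t : ℕ, ‖σ.x t - xh (t + n)‖ = ‖e (n + t)‖ := by
    intro t
    simp only [he]
    rw [add_comm n t, show ((t + n : ℕ) : ℤ) - n = t by push_cast; ring]
  rw [Finset.sum_congr rfl fun t _ => h2 t]
  have h3 : 0 ≤ ∑ t ∈ Finset.range n, ‖e t‖ := Finset.sum_nonneg fun _ _ => norm_nonneg _
  have h4 := mul_le_mul_of_nonneg_left h0 hK
  linarith

/-- The closed loop tracks the estimated optimal steady states. -/
theorem exists_tracking_bound (h_schur : sys.SchurStable) (h_ctrb : sys.Controllable)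
    (h_obsv : sys.Observable) (h_data : sys.IsTrajectory P.ud P.yd) (h_horizon : sys.ctrbIndex ≤ μ)
    (h_pe : PersistentlyExciting P.ud (3 * n + μ + 1)) :
    ∃ c ce : ℝ, 0 ≤ c ∧ ∀ init : AlgInit n m p μ, sys.IsTrajectory init.u init.yc →
      ∃ A : ℝ, ∀ (cost : ℤ → IOSpace m p → ℝ)
        (σ : Signals n m p μ (N + 1 - (2 * n + μ + 1))), IsClosedLoop sys P init cost σ →
        ∀ T : ℕ, ∑ t ∈ Finset.range (T + 1), ‖σ.z t - σ.zs t‖ ≤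
          A + c * ∑ t ∈ Finset.range T, ‖σ.zs (t + 1 : ℕ) - σ.zs t‖ + ce * σ.E₀ := by
  obtain ⟨x, hx⟩ := h_data.exists_isStateOf
  obtain ⟨K, hK, hgain, hsteady⟩ := h_schur.exists_gain
  obtain ⟨cB, hcB, hB⟩ := exists_norm_mulVec_le sys.B
  obtain ⟨cC, hcC, hC⟩ := exists_norm_mulVec_le sys.C
  obtain ⟨cD, hcD, hD⟩ := exists_norm_mulVec_le sys.D
  obtain ⟨cz, hcz, hz⟩ := exists_norm_ioPair_le m p
  obtain ⟨cu, hcu, hu⟩ := exists_uhat_bound h_ctrb h_obsv h_data h_horizon h_pe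
  obtain ⟨ce, hce, hnoise⟩ := exists_noise_bound h_schur h_ctrb h_obsv h_data h_horizon h_pe
  refine ⟨cz * ((1 + cD) * cu + cC * (K * (cB * cu + K * cB))), cz * (cC * ce), by positivity,
    fun init hinit => ?_⟩
  obtain ⟨A₀, hA₀, hbound⟩ := exists_init_bound h_ctrb h_obsv h_data h_horizon h_pe hinit
  obtain ⟨Au, hAu, hu⟩ := hu init hinit
  obtain ⟨xi, hxi⟩ := id hinit
  refine ⟨cz * ((1 + cD) * Au + cC * (K * (‖xi n‖ + K * (cB * A₀) + cB * Au))),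
    fun cost σ hσ T => ?_⟩
  set xh := sys.sim (xi 0) (fun k => σ.u (k - n)) with hxh
  set Δ := ∑ t ∈ Finset.range T, ‖σ.zs (t + 1 : ℕ) - σ.zs t‖ with hΔ
  have hmem : ∀ t : ℕ, σ.zs t ∈ sys.steadyStates := fun t =>
    (AlgParams.S_mulVec_eq_zero_iff hx h_ctrb h_obsv h_pe _).1 (hσ.S_mulVec_zs t)
  choose xs hs hys using hmem
  have hcast : ∀ t : ℕ, ((t + n : ℕ) : ℤ) - n = t := fun t => by push_cast; ring
  have hest := hσ.estimate hx h_ctrb h_obsv h_horizon h_pe hxi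
  -- The deviation from `zs` splits into the input error `v`, the distance `ξ` of the simulated
  -- state from the steady state, and the estimation error `e`.
  set v : ℕ → Fin m → ℝ := fun t => σ.u t - inPart (σ.zs t) with hv
  set ξ : ℕ → Fin n → ℝ := fun t => xh (t + n) - xs t with hξ
  set e : ℕ → Fin n → ℝ := fun t => σ.x t - xh (t + n) with he
  have hvsum : ∑ t ∈ Finset.range (T + 1), ‖v t‖ ≤ Au + cu * Δ := hu cost σ hσ T
  have hvsum' : ∑ t ∈ Finset.range T, ‖v t‖ ≤ Au + cu * Δ := by
    rw [Finset.sum_range_succ] at hvsum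
    linarith [norm_nonneg (v T)]
  have hesum : ∑ t ∈ Finset.range (T + 1), ‖e t‖ ≤ ce * σ.E₀ := hnoise init xi hxi cost σ hσ T
  have hxs : ∀ t : ℕ, ‖xs t - xs (t + 1)‖ ≤ K * (cB * ‖σ.zs (t + 1 : ℕ) - σ.zs t‖) := by
    intro t
    have h1 := hsteady (xs t - xs (t + 1))
      (sys.B *ᵥ (inPart (σ.zs t) - inPart (σ.zs (t + 1 : ℕ)))) (by
        conv_lhs => rw [hs t, hs (t + 1)]
        rw [Matrix.mulVec_sub, Matrix.mulVec_sub]; abel)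
    refine h1.trans (mul_le_mul_of_nonneg_left ((hB _).trans
      (mul_le_mul_of_nonneg_left ?_ hcB)) hK)
    rw [norm_sub_rev]
    exact norm_inPart_le (σ.zs (t + 1 : ℕ) - σ.zs t)
  -- The stable dynamics of `ξ` are driven by the input error and by the motion of the steady state.
  have hξstep : ∀ t, ξ (t + 1) = sys.A *ᵥ ξ t + (sys.B *ᵥ v t + (xs t - xs (t + 1))) := by
    intro t
    have h1 : xh (t + 1 + n) = sys.A *ᵥ xh (t + n) + sys.B *ᵥ σ.u t := by
      rw [Nat.add_right_comm t 1 n, hxh, LTI.sim, hcast]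
    have h2 : sys.B *ᵥ inPart (σ.zs t) = xs t - sys.A *ᵥ xs t := by
      rw [eq_sub_iff_add_eq', ← hs t]
    simp only [hξ, hv]
    rw [h1, Matrix.mulVec_sub, Matrix.mulVec_sub, h2]
    abel
  have hξ0 : ‖ξ 0‖ ≤ ‖xi n‖ + K * (cB * A₀) := by
    have h1 : xh (0 + n) = xi n := by
      rw [zero_add]
      symm
      refine sys.eq_sim rfl (fun i hi => ?_) le_rfl
      have h2 := congrFun hσ.init_u ⟨i, hi⟩
      rw [window, show (0 : ℤ) - n + (i : ℕ) = (i : ℤ) - n by ring] at h2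
      rw [h2]
      exact (hxi ⟨i, hi⟩).1
    have h3 := hsteady (xs 0) _ (hs 0)
    have h4 : ‖inPart (σ.zs (0 : ℕ))‖ ≤ A₀ := (norm_inPart_le _).trans (hbound cost σ hσ).1
    refine (norm_sub_le _ _).trans ?_
    rw [h1]
    exact add_le_add_right (h3.trans (mul_le_mul_of_nonneg_left ((hB _).trans
      (mul_le_mul_of_nonneg_left h4 hcB)) hK)) _
  have hξsum : ∑ t ∈ Finset.range (T + 1), ‖ξ t‖ ≤
      K * (‖xi n‖ + K * (cB * A₀) + (cB * (Au + cu * Δ) + K * (cB * Δ))) := by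
    refine (hgain ξ _ hξstep T).trans (mul_le_mul_of_nonneg_left (add_le_add hξ0 ?_) hK)
    have h1 : ∀ t ∈ Finset.range T, ‖sys.B *ᵥ v t + (xs t - xs (t + 1))‖ ≤
        cB * ‖v t‖ + K * (cB * ‖σ.zs (t + 1 : ℕ) - σ.zs t‖) := fun t _ =>
      (norm_add_le _ _).trans (add_le_add (hB _) (hxs t))
    refine (Finset.sum_le_sum h1).trans ?_
    rw [Finset.sum_add_distrib, ← Finset.mul_sum, ← Finset.mul_sum, ← Finset.mul_sum]
    exact add_le_add_left (mul_le_mul_of_nonneg_left hvsum' hcB) _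
  have hterm : ∀ t ∈ Finset.range (T + 1), ‖σ.z t - σ.zs t‖ ≤
      cz * ((1 + cD) * ‖v t‖ + cC * ‖ξ t‖ + cC * ‖e t‖) := by
    intro t _
    have h1 : σ.z t - σ.zs t = ioPair (v t) (sys.C *ᵥ e t + sys.C *ᵥ ξ t + sys.D *ᵥ v t) := by
      have h2 : σ.y t - outPart (σ.zs t) = sys.C *ᵥ e t + sys.C *ᵥ ξ t + sys.D *ᵥ v t := by
        rw [hσ.output_eq t (by omega), hys t]
        simp only [he, hξ, hv, Matrix.mulVec_sub]
        abel
      rw [← h2]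
      ext i
      cases i <;> rfl
    rw [h1]
    refine (hz _ _).trans (mul_le_mul_of_nonneg_left ?_ hcz)
    have h3 := norm_add₃_le (a := sys.C *ᵥ e t) (b := sys.C *ᵥ ξ t) (c := sys.D *ᵥ v t)
    linarith [hC (e t), hC (ξ t), hD (v t)]
  refine (Finset.sum_le_sum hterm).trans ?_
  rw [← Finset.mul_sum, Finset.sum_add_distrib, Finset.sum_add_distrib, ← Finset.mul_sum,
    ← Finset.mul_sum, ← Finset.mul_sum]
  have h1 := mul_le_mul_of_nonneg_left hvsum (by positivity : 0 ≤ 1 + cD)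
  have h2 := mul_le_mul_of_nonneg_left hξsum hcC
  have h3 := mul_le_mul_of_nonneg_left hesum hcC
  refine (mul_le_mul_of_nonneg_left (add_le_add (add_le_add h1 h2) h3) hcz).trans (le_of_eq ?_)
  ring

end

end DDOCO

/-! ### Assembly of the regret bound -/

theorem theorem2 {n m p μ N r : ℕ} (sys : DDOCO.LTI n m p) (P : DDOCO.AlgParams n m p μ N r)
    (αz lz Lz : ℝ) (hαz : 0 < αz) (hlz : 0 < lz) (hLz : 0 < Lz)
    (h_schur : sys.SchurStable) (h_ctrb : sys.Controllable) (h_obsv : sys.Observable)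
    (h_data : sys.IsTrajectory P.ud P.yd)
    (h_horizon : sys.ctrbIndex ≤ μ)
    (h_pe : DDOCO.PersistentlyExciting P.ud (3 * n + μ + 1))
    (hγ : 0 < P.γ) (hγ' : P.γ ≤ 2 / (αz + lz)) :
    ∃ Cζ Ce : ℝ, ∀ init : DDOCO.AlgInit n m p μ, sys.IsTrajectory init.u init.yc →
      ∃ Cμ : ℝ, ∀ (cost : ℤ → DDOCO.IOSpace m p → ℝ)
        (σ : DDOCO.Signals n m p μ (N + 1 - (2 * n + μ + 1)))
        (ζ : ℤ → DDOCO.IOSpace m p) (Z : Set (DDOCO.IOSpace m p)),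
        (∀ t : ℤ, 0 ≤ t → DDOCO.StronglyConvexSmooth αz lz (cost t)) →
        (∀ t : ℤ, 0 ≤ t → ∀ z₁ ∈ Z, ∀ z₂ ∈ Z,
          |cost t z₁ - cost t z₂| ≤ Lz * ‖z₁ - z₂‖) →
        DDOCO.IsClosedLoop sys P init cost σ →
        (∀ t : ℤ, 0 ≤ t → sys.IsOptimalSteadyState (cost t) (ζ t)) →
        ζ (-1) = init.zs →
        (∀ t : ℤ, 0 ≤ t → σ.z t ∈ Z ∧ ζ t ∈ Z) →
        ∀ T : ℕ,
          ∑ t ∈ Finset.range (T + 1), (cost t (σ.z t) - cost t (ζ t)) ≤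
            Cμ + Cζ * ∑ t ∈ Finset.range (T + 1), ‖ζ t - ζ ((t : ℤ) - 1)‖ + Ce * σ.E₀ := by

  open DDOCO in
  obtain ⟨x, hx⟩ := h_data.exists_isStateOf
  obtain ⟨c, ce, hc, htrack⟩ :=
    exists_tracking_bound h_schur h_ctrb h_obsv h_data h_horizon h_pe
  set κ := gradientRate αz lz P.γ with hκ
  have hκ0 : 0 ≤ κ := Real.sqrt_nonneg _
  have hκ1 : κ < 1 := gradientRate_lt_one hαz hlz hγ
  have hκ' : 0 < (1 - κ)⁻¹ := inv_pos.2 (sub_pos.2 hκ1)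
  refine ⟨Lz * (c * (2 * (1 - κ)⁻¹ + 1) + (1 - κ)⁻¹), Lz * ce, fun init hinit => ?_⟩
  obtain ⟨A₀, hA₀, hbound⟩ := exists_init_bound h_ctrb h_obsv h_data h_horizon h_pe hinit
  obtain ⟨A, htrack⟩ := htrack init hinit
  refine ⟨Lz * (A + (2 * c + 1) * ((1 - κ)⁻¹ * (A₀ + ‖init.zs‖))),
    fun cost σ ζ Z hcost hlip hσ hζ hζ0 hZ T => ?_⟩
  have hcast : ∀ t : ℕ, ((t + 1 : ℕ) : ℤ) - 1 = t := fun t => by push_cast; ring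
  set a : ℕ → ℝ := fun t => ‖σ.zs t - ζ t‖ with ha
  set d : ℕ → ℝ := fun t => ‖ζ t - ζ ((t : ℤ) - 1)‖ with hd
  set δ : ℕ → ℝ := fun t => ‖σ.zs (t + 1 : ℕ) - σ.zs t‖ with hδ
  have hker := fun z => AlgParams.S_mulVec_eq_zero_iff hx h_ctrb h_obsv h_pe z
  -- The step at time `t + 1` uses the cost of time `t`, so it approaches `ζ t`; this lag produces
  -- `d (t + 1)` in the recursion.
  have hcontr : ∀ t : ℕ, ‖σ.zs (t + 1 : ℕ) - ζ t‖ ≤ κ * a t := by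
    intro t
    have ht : (0 : ℤ) ≤ t := Int.natCast_nonneg t
    rw [hσ.zs_eq_kerProj, hcast, hσ.zμ_succ hx h_ctrb h_obsv h_horizon h_pe hinit]
    exact (hcost t ht).norm_kerProj_step_le hαz hlz hγ hγ' P.S (hσ.S_mulVec_zs t)
      ((hker _).2 (hζ t ht).1) fun z hz => (hζ t ht).2 z ((hker z).1 hz)
  have hstep : ∀ t : ℕ, a (t + 1) ≤ κ * a t + d (t + 1) := by
    intro t
    have h1 := norm_sub_le_norm_sub_add_norm_sub (σ.zs (t + 1 : ℕ)) (ζ t) (ζ (t + 1 : ℕ))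
    have h2 : d (t + 1) = ‖ζ t - ζ (t + 1 : ℕ)‖ := by
      simp only [hd]
      rw [hcast, norm_sub_rev]
    rw [h2]
    linarith [hcontr t]
  -- The first step uses the arbitrary `L_{-1}` and need not contract. The convention `ζ (-1) = zs
  -- (-1)` lets `d 0` absorb the distance to `ζ 0`.
  have hzero : a 0 ≤ (A₀ + ‖init.zs‖) + d 0 := by
    have h1 := norm_sub_le_norm_sub_add_norm_sub (σ.zs (0 : ℕ)) init.zs (ζ (0 : ℕ))
    have h2 := (norm_sub_le (σ.zs (0 : ℕ)) init.zs).trans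
      (add_le_add_left (hbound cost σ hσ).1 _)
    have h3 : d 0 = ‖init.zs - ζ (0 : ℕ)‖ := by
      simp only [hd]
      rw [← hζ0, norm_sub_rev]
      rfl
    rw [h3]
    linarith
  have hasum := sum_le_of_contraction (a := a) (d := d) hκ0 hκ1 (fun t => norm_nonneg _) hzero hstep T
  have hδsum : ∑ t ∈ Finset.range T, δ t ≤
      2 * ∑ t ∈ Finset.range (T + 1), a t + ∑ t ∈ Finset.range (T + 1), d t := by
    have h1 : ∀ t ∈ Finset.range T, δ t ≤ a t + a (t + 1) + d (t + 1) := by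
      intro t _
      have h2 := norm_sub_le_norm_sub_add_norm_sub (σ.zs (t + 1 : ℕ)) (ζ t) (σ.zs t)
      have h3 := norm_sub_le_norm_sub_add_norm_sub (σ.zs (t + 1 : ℕ)) (ζ (t + 1 : ℕ)) (ζ t)
      have h4 : d (t + 1) = ‖ζ (t + 1 : ℕ) - ζ t‖ := by simp only [hd]; rw [hcast]
      have h5 : a t = ‖ζ t - σ.zs t‖ := norm_sub_rev _ _
      rw [h4, h5]
      exact h2.trans (by linarith)
    refine (Finset.sum_le_sum h1).trans ?_
    rw [Finset.sum_add_distrib, Finset.sum_add_distrib]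
    have h2 := Finset.sum_range_succ a T
    have h3 := Finset.sum_range_succ' a T
    have h4 := Finset.sum_range_succ' d T
    have h5 : 0 ≤ a T := norm_nonneg _
    have h6 : 0 ≤ a 0 := norm_nonneg _
    have h7 : 0 ≤ d 0 := norm_nonneg _
    linarith
  have hterm : ∀ t ∈ Finset.range (T + 1), cost t (σ.z t) - cost t (ζ t) ≤
      Lz * (‖σ.z t - σ.zs t‖ + a t) := by
    intro t _
    have ht : (0 : ℤ) ≤ t := Int.natCast_nonneg t
    -- Lipschitz continuity is available only on `Z`, which need not contain `zs t`; so `zs t`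
    -- enters through the triangle inequality for the norm.
    refine (le_abs_self _).trans ((hlip t ht _ (hZ t ht).1 _ (hZ t ht).2).trans ?_)
    exact mul_le_mul_of_nonneg_left (norm_sub_le_norm_sub_add_norm_sub _ _ _) hLz.le
  refine (Finset.sum_le_sum hterm).trans ?_
  rw [← Finset.mul_sum, Finset.sum_add_distrib]
  have h1 : ∑ t ∈ Finset.range (T + 1), ‖σ.z t - σ.zs t‖ ≤
      A + c * ∑ t ∈ Finset.range T, δ t + ce * σ.E₀ := htrack cost σ hσ T
  have h2 := mul_le_mul_of_nonneg_left hδsum hc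
  have h3 := mul_le_mul_of_nonneg_left hasum (by positivity : 0 ≤ 2 * c + 1)
  have h4 : ∑ t ∈ Finset.range (T + 1), ‖σ.z t - σ.zs t‖ + ∑ t ∈ Finset.range (T + 1), a t ≤
      (A + (2 * c + 1) * ((1 - κ)⁻¹ * (A₀ + ‖init.zs‖))) +
        (c * (2 * (1 - κ)⁻¹ + 1) + (1 - κ)⁻¹) * ∑ t ∈ Finset.range (T + 1), d t +
        ce * σ.E₀ := by
    linarith
  refine (mul_le_mul_of_nonneg_left h4 hLz.le).trans (le_of_eq ?_)
  ring
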